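/- Let $\Theta=(\theta_m)_{m\ge 1}$ be a sequence of real numbers with $\theta_m\ge 0$. For $\sigma$ in the symmetric group $S_n$ let $C_m(\sigma)=C_m^{(n)}(\sigma)$ be the number of cycles of length $m$ of $\sigma$ (fixed points being cycles of length $1$), and put $$h_n=\frac1{n!}\sum_{\sigma\in S_n}\prod_{m=1}^n\theta_m^{C_m(\sigma)}\quad(h_0=1),\qquad \mathbb P_\Theta[\sigma]=\frac{1}{h_n\,n!}\prod_{m=1}^n\theta_m^{C_m(\sigma)}\quad\text{on } S_n \text{ if } h_n>0 .$$ Write $\mathbb E_\Theta$ for the expectation under $\mathbb P_\Theta$ (if $h_n=0$, the product $h_n\mathbb E_\Theta[\cdot]$ is read as $0$), and define the formal power series $g_\Theta(t)=\sum_{k\ge1}\frac{\theta_k}{k}t^k$ and $G_\Theta(t)=\exp(g_\Theta(t))$. For $0<r<R$ and $0<\phi<\pi/2$ let $\Delta_0(r,R,\phi)=\{z\in\mathbb C: |z|<R,\ z\ne r,\ |\arg(z-r)|>\phi\}$, where $\arg$ is the principal argument; $\log$ denotes the principal logarithm. Let $g$ be a power series and let $r>0$, $\theta\ge0$. * $g$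 is of class $\mathcal F(r,\theta)$ if for some $R>r$ and $0<\phi<\pi/2$ it is the Taylor series at $0$ of a function, also denoted $g$, which is holomorphic in $\Delta_0(r,R,\phi)$ and satisfies, for some constant $K$, $g(t)=\theta\log\frac1{1-t/r}+K+O(t-r)$ as $t\to r$ in $\Delta_0(r,R,\phi)$. * $g$ is of class $e\mathcal F(r,\theta,\gamma)$, where $0<\gamma\le1$, if $g$ converges in the disc $\{|t|<r\}$ and there is an analytic function $g_0$ in this disc with $g(t)=\theta\log\frac1{1-t/r}+g_0(t)$ for all $t$ in the disc sufficiently close to $r$, and whose Taylor coefficients at $0$ satisfy $[t^n]g_0=O(r^{-n}n^{-1-\gamma})$. **Theorem.** Let $b\in\mathbb N$ be fixed. 1. For all real $s_1,\dots,s_b$, as formal power series in $t$, $$\sum_{n=0}^\infty h_n\,\mathbb E_\Theta\Big[\exp\Big(i\sum_{m=1}^b s_mC_m^{(n)}\Big)\Big]t^n=\exp\Big(\sum_{m=1}^b\frac{\theta_m}{m}(e^{is_m}-1)t^m\Big)\,G_\Theta(t).$$ 2. If $g_\Theta$ is of class $\mathcal F(r,\theta)$ with $\theta>0$, then $h_n>0$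 for all sufficiently large $n$ and, as $n\to\infty$, uniformly in $(s_1,\dots,s_b)\in\mathbb R^b$, $$\mathbb E_\Theta\Big[\exp\Big(i\sum_{m=1}^b s_mC_m^{(n)}\Big)\Big]=\exp\Big(\sum_{m=1}^b\frac{\theta_m}{m}(e^{is_m}-1)r^m\Big)+O\Big(\frac1n\Big).$$ 3. If $g_\Theta$ is of class $e\mathcal F(r,\theta,\gamma)$ with $\theta>0$, then $h_n>0$ for all sufficiently large $n$ and, as $n\to\infty$, uniformly in $(s_1,\dots,s_b)\in\mathbb R^b$, $$\mathbb E_\Theta\Big[\exp\Big(i\sum_{m=1}^b s_mC_m^{(n)}\Big)\Big]=\exp\Big(\sum_{m=1}^b\frac{\theta_m}{m}(e^{is_m}-1)r^m\Big)+O\Big(\frac{\log n}{n^\gamma}\Big).$$ -/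

import Mathlib

open Filter Topology Asymptotics

noncomputable section

namespace WeightedPerm

/-- The number `C_m(σ)` of cycles of length `m` of `σ` (fixed points are cycles of length one). -/
def cycleCount {n : ℕ} (m : ℕ) (σ : Equiv.Perm (Fin n)) : ℕ :=
  σ.partition.parts.count m

/-- The weight `∏_{m=1}^n θ_m ^ C_m(σ)`; the entry `θ 0` of the sequence is never used. -/
def weight (θ : ℕ → ℝ) {n : ℕ} (σ : Equiv.Perm (Fin n)) : ℝ :=
  ∏ m ∈ Finset.Icc 1 n, θ m ^ cycleCount m σ

/-- The normalization constant `h_n(Θ)`. -/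
def h (θ : ℕ → ℝ) (n : ℕ) : ℝ :=
  (1 / (n.factorial : ℝ)) * ∑ σ : Equiv.Perm (Fin n), weight θ σ

/-- The mass `P_Θ(σ)`. It is a probability mass function as soon as `h θ n ≠ 0`. -/
def prob (θ : ℕ → ℝ) {n : ℕ} (σ : Equiv.Perm (Fin n)) : ℝ :=
  (1 / (h θ n * (n.factorial : ℝ))) * weight θ σ

/-- The expectation of a complex valued random variable on `S_n` under `P_Θ`. -/
def expectation (θ : ℕ → ℝ) {n : ℕ} (X : Equiv.Perm (Fin n) → ℂ) : ℂ :=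
  ∑ σ : Equiv.Perm (Fin n), (prob θ σ : ℂ) * X σ

/-- The joint characteristic function of `(C_1, …, C_b)` under `P_Θ` on `S_n`,
at the point `(s_1, …, s_b)`. -/
def charFn (θ : ℕ → ℝ) (n b : ℕ) (s : ℕ → ℝ) : ℂ :=
  expectation θ fun σ : Equiv.Perm (Fin n) =>
    Complex.exp (Complex.I * ∑ m ∈ Finset.Icc 1 b, (s m : ℂ) * (cycleCount m σ : ℂ))

theorem h_zero (θ : ℕ → ℝ) : h θ 0 = 1 := by
  simp [h, weight]

theorem sum_prob (θ : ℕ → ℝ) {n : ℕ} (hn : h θ n ≠ 0) :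
    ∑ σ : Equiv.Perm (Fin n), prob θ σ = 1 := by
  have hf : (n.factorial : ℝ) ≠ 0 := by exact_mod_cast n.factorial_ne_zero
  have key : ∑ σ : Equiv.Perm (Fin n), weight θ σ = h θ n * (n.factorial : ℝ) := by
    unfold h
    field_simp
  unfold prob
  rw [← Finset.mul_sum, key]
  field_simp

/-- The formal power series `g_Θ(t) = ∑_{k ≥ 1} (θ_k / k) t^k`. -/
def gSeries (θ : ℕ → ℝ) : PowerSeries ℂ :=
  PowerSeries.mk fun k => if k = 0 then 0 else (θ k : ℂ) / (k : ℂ)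

/-- The polynomial `∑_{m=1}^b (θ_m / m) (e^{i s_m} - 1) t^m`, as a formal power series. -/
def cycleSeries (θ : ℕ → ℝ) (b : ℕ) (s : ℕ → ℝ) : PowerSeries ℂ :=
  ∑ m ∈ Finset.Icc 1 b,
    PowerSeries.C ((θ m : ℂ) / (m : ℂ) * (Complex.exp (Complex.I * (s m : ℂ)) - 1)) *
      PowerSeries.X ^ m

/-- The formal exponential `exp(f(t))` of a power series `f` without constant term. -/
def formalExp (f : PowerSeries ℂ) : PowerSeries ℂ :=
  (PowerSeries.exp ℂ).subst f

theorem hasSubst_gSeries (θ : ℕ → ℝ) : PowerSeries.HasSubst (gSeries θ) := by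
  apply PowerSeries.HasSubst.of_constantCoeff_zero'
  simp [gSeries, ← PowerSeries.coeff_zero_eq_constantCoeff_apply]

theorem hasSubst_cycleSeries (θ : ℕ → ℝ) (b : ℕ) (s : ℕ → ℝ) :
    PowerSeries.HasSubst (cycleSeries θ b s) := by
  apply PowerSeries.HasSubst.of_constantCoeff_zero'
  unfold cycleSeries
  rw [map_sum]
  refine Finset.sum_eq_zero fun m hm => ?_
  have : m ≠ 0 := by
    have := (Finset.mem_Icc.mp hm).1
    omega
  simp [this]

/-- The formal power series `G_Θ(t) = exp(g_Θ(t))`. -/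
def GSeries (θ : ℕ → ℝ) : PowerSeries ℂ :=
  formalExp (gSeries θ)

/-- The value at `t = r` of `exp(∑_{m=1}^b (θ_m / m) (e^{i s_m} - 1) t^m)`. -/
def limitCharFn (θ : ℕ → ℝ) (r : ℝ) (b : ℕ) (s : ℕ → ℝ) : ℂ :=
  Complex.exp (∑ m ∈ Finset.Icc 1 b,
    (θ m : ℂ) / (m : ℂ) * (Complex.exp (Complex.I * (s m : ℂ)) - 1) * (r : ℂ) ^ m)

/-- The domain `Δ₀(r, R, φ)`. -/
def Delta0 (r R φ : ℝ) : Set ℂ :=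
  {z : ℂ | ‖z‖ < R ∧ z ≠ (r : ℂ) ∧ φ < |Complex.arg (z - (r : ℂ))|}

/-- The power series `g` is of class `F(r, θ)`: it is the Taylor series at `0` of a function `f`
holomorphic in some `Δ₀(r, R, φ)`, and
`f(t) = θ log(1 / (1 - t/r)) + K + O(t - r)` as `t → r` in `Δ₀(r, R, φ)`. -/
def ClassF (g : PowerSeries ℂ) (r θ : ℝ) : Prop :=
  0 < r ∧ 0 ≤ θ ∧
  ∃ R φ : ℝ, r < R ∧ 0 < φ ∧ φ < Real.pi / 2 ∧
  ∃ f : ℂ → ℂ,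
    DifferentiableOn ℂ f (Delta0 r R φ) ∧
    (∀ᶠ t in 𝓝 (0 : ℂ), HasSum (fun n : ℕ => PowerSeries.coeff n g * t ^ n) (f t)) ∧
    ∃ K : ℂ,
      (fun t : ℂ => f t - ((θ : ℂ) * Complex.log (1 / (1 - t / (r : ℂ))) + K))
        =O[𝓝[Delta0 r R φ] (r : ℂ)] (fun t : ℂ => t - (r : ℂ))

/-- The power series `g` is of class `eF(r, θ, γ)`: it converges in the disc `|t| < r`, and its sum
there is `θ log(1 / (1 - t/r)) + g₀(t)` for `t` close to `r`, where `g₀` is analytic in the disc and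
its Taylor coefficients at `0` are `O(r^{-n} n^{-1-γ})`. -/
def ClassEF (g : PowerSeries ℂ) (r θ γ : ℝ) : Prop :=
  0 < r ∧ 0 ≤ θ ∧ 0 < γ ∧ γ ≤ 1 ∧
  ∃ f g₀ : ℂ → ℂ,
    (∀ t ∈ Metric.ball (0 : ℂ) r, HasSum (fun n : ℕ => PowerSeries.coeff n g * t ^ n) (f t)) ∧
    AnalyticOnNhd ℂ g₀ (Metric.ball (0 : ℂ) r) ∧
    (∀ᶠ t in 𝓝[Metric.ball (0 : ℂ) r] (r : ℂ),
      f t = (θ : ℂ) * Complex.log (1 / (1 - t / (r : ℂ))) + g₀ t) ∧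
    (fun n : ℕ => iteratedDeriv n g₀ 0 / (n.factorial : ℂ))
      =O[atTop] (fun n : ℕ => (r ^ n)⁻¹ * (n : ℝ) ^ (-1 - γ))

end WeightedPerm

end

noncomputable section

namespace WeightedPerm

/-! Sorting permutations by cycle type turns `h_n` times the characteristic function into a cycle
index sum with tilted weights `θ_m e^{i s_m}`. Removing one part from a partition shows that such
sums satisfy `n a_n = ∑ w_k a_{n-k}`, which is the differential equation `E' = f' E` read
coefficientwise. So the generating function is a formal exponential (`mk_partitionSum`), and it
factors as in the first claim (`mk_h_mul_charFn`).

For the asymptotics, take the singular factor `(1 - t/r)^{-θ}` out of `G_Θ`. Its coefficients are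
`p_n r^{-n}` with `p = risingBinom θ`, and the remaining factor should act through its value at `r`,
namely a constant `S` times the limiting characteristic function. It suffices to show this with an
error relative to `p_n`, uniformly in `s`: the case `s = 0` then controls `h_n`, and dividing gives
both estimates (`charFn_estimate_of_coeff_estimate`).

For class `eF`, sequences of size `n^{-1-γ}` are stable under convolution, hence under the formal
exponential. The remaining factor has such coefficients, and convolving them with `p` costs `log n /
n^γ` (`norm_sum_mul_risingBinom_sub_le`).

For class `F`, the difference `H` between the generating function and its singular model is of size
`|t - r|^{1-θ}`. Cauchy estimates on discs of radius proportional to `|t - r|` bound `H''` by `|t -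
r|^{-1-θ}`, and integrating over circles inside the disc gives coefficients of order `r^{-n}
n^{θ-2}`, smaller than `p_n r^{-n}` by a factor `n`. The larger domain serves only to provide room
for these small discs. -/

/-! ### Formal exponentials and the equation `E' = f' E` -/

open PowerSeries in
theorem constantCoeff_formalExp {f : PowerSeries ℂ} (hf : constantCoeff f = 0) :
    constantCoeff (formalExp f) = 1 := by
  have hs := HasSubst.of_constantCoeff_zero' hf
  rw [formalExp, ← coeff_zero_eq_constantCoeff_apply, coeff_subst' hs,
    finsum_eq_single _ 0]
  · simp
  · intro d hd
    simp [hf, hd]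

open PowerSeries in
theorem derivative_formalExp {f : PowerSeries ℂ} (hf : constantCoeff f = 0) :
    d⁄dX ℂ (formalExp f) = d⁄dX ℂ f * formalExp f := by
  rw [formalExp, derivative_subst (HasSubst.of_constantCoeff_zero' hf), derivative_exp, mul_comm]

open PowerSeries in
/-- A solution of `E' = f' E` is a constant multiple of `formalExp f`. -/
theorem eq_C_mul_formalExp {f E : PowerSeries ℂ} (hf : constantCoeff f = 0)
    (hE : d⁄dX ℂ E = d⁄dX ℂ f * E) : E = C (constantCoeff E) * formalExp f := by
  have hnf : constantCoeff (-f) = 0 := by simp [hf]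
  -- Multiplying a solution by `exp (-f)` gives derivative zero, hence a constant. This is applied
  -- both to `E` and to `exp f` itself.
  have key : ∀ E : PowerSeries ℂ, d⁄dX ℂ E = d⁄dX ℂ f * E →
      E * formalExp (-f) = C (constantCoeff E) := by
    intro E hE
    apply derivative.ext
    · rw [Derivation.leibniz, hE, derivative_formalExp hnf, derivative_C, map_neg]
      simp only [smul_eq_mul]
      ring
    · simp [constantCoeff_formalExp hnf]
  have h1 := key _ (derivative_formalExp hf)
  rw [constantCoeff_formalExp hf, map_one] at h1
  calc E = E * (formalExp f * formalExp (-f)) := by rw [h1, mul_one]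
    _ = E * formalExp (-f) * formalExp f := by ring
    _ = _ := by rw [key E hE]

open PowerSeries in
theorem formalExp_add {f g : PowerSeries ℂ} (hf : constantCoeff f = 0)
    (hg : constantCoeff g = 0) : formalExp (f + g) = formalExp f * formalExp g := by
  have hfg : constantCoeff (f + g) = 0 := by simp [hf, hg]
  have := eq_C_mul_formalExp (E := formalExp f * formalExp g) hfg (by
    rw [Derivation.leibniz, derivative_formalExp hf, derivative_formalExp hg, map_add]
    simp only [smul_eq_mul]
    ring)
  rw [this]
  simp [constantCoeff_formalExp hf, constantCoeff_formalExp hg]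

-- The sum is finite because `f ^ k` has order at least `k`.
open PowerSeries in
theorem coeff_formalExp {f : PowerSeries ℂ} (hf : constantCoeff f = 0) (n : ℕ) :
    coeff n (formalExp f) =
      ∑ k ∈ Finset.range (n + 1), ((k.factorial : ℂ))⁻¹ * coeff n (f ^ k) := by
  rw [formalExp, coeff_subst' (HasSubst.of_constantCoeff_zero' hf),
    finsum_eq_sum_of_support_subset]
  · refine Finset.sum_congr rfl fun k _ => ?_
    simp
  · intro k hk
    by_contra hk'
    apply hk
    simp only [Finset.coe_range, Set.mem_Iio, not_lt] at hk'
    have : coeff n (f ^ k) = 0 :=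
      coeff_of_lt_order _ (lt_of_lt_of_le (by exact_mod_cast hk')
        (le_order_pow_of_constantCoeff_eq_zero k hf))
    simp [this]

open PowerSeries in
theorem rescale_formalExp {f : PowerSeries ℂ} (hf : constantCoeff f = 0) (r : ℂ) :
    rescale r (formalExp f) = formalExp (rescale r f) := by
  ext n
  have hf' : constantCoeff (rescale r f) = 0 := by
    rw [← coeff_zero_eq_constantCoeff_apply, coeff_rescale]
    simp [hf]
  rw [coeff_rescale, coeff_formalExp hf, coeff_formalExp hf', Finset.mul_sum]
  refine Finset.sum_congr rfl fun k _ => ?_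
  rw [← map_pow, coeff_rescale]
  ring

open PowerSeries in
/-- If `n a_n = ∑_{k=1}^n w_k a_{n-k}` and `a_0 = 1`, then `∑ a_n X^n = exp (∑ w_k X^k / k)`. -/
theorem mk_eq_formalExp_of_recurrence {a w : ℕ → ℂ} (h0 : a 0 = 1)
    (hrec : ∀ n : ℕ, ((n : ℂ) + 1) * a (n + 1) =
      ∑ k ∈ Finset.range (n + 1), w (k + 1) * a (n - k)) :
    PowerSeries.mk a =
      formalExp (PowerSeries.mk fun k => if k = 0 then 0 else w k / (k : ℂ)) := by
  have hf : constantCoeff (PowerSeries.mk fun k => if k = 0 then 0 else w k / (k : ℂ)) = 0 := by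
    simp [← coeff_zero_eq_constantCoeff_apply]
  have := eq_C_mul_formalExp (E := PowerSeries.mk a) hf (by
    ext n
    rw [coeff_derivative, coeff_mk, coeff_mul, mul_comm, hrec,
      Finset.Nat.sum_antidiagonal_eq_sum_range_succ_mk]
    refine Finset.sum_congr rfl fun k _ => ?_
    rw [coeff_derivative, coeff_mk, coeff_mk, if_neg k.succ_ne_zero]
    have : ((k : ℂ) + 1) ≠ 0 := by exact_mod_cast k.succ_ne_zero
    push_cast
    field_simp)
  rw [this]
  simp [← coeff_zero_eq_constantCoeff_apply, h0]

/-! ### Cycle types and the cycle index -/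

/-- The order of the centralizer of a permutation whose cycle lengths are the elements of `s`. -/
def centralizerOrder (s : Multiset ℕ) : ℕ :=
  s.prod * ∏ i ∈ s.toFinset, (s.count i).factorial

theorem prod_factorial_count_eq (s : Multiset ℕ) {t : Finset ℕ} (h : s.toFinset ⊆ t) :
    ∏ i ∈ s.toFinset, (s.count i).factorial = ∏ i ∈ t, (s.count i).factorial := by
  refine Finset.prod_subset h fun i _ hi => ?_
  rw [Multiset.count_eq_zero.mpr (by simpa using hi), Nat.factorial_zero]

theorem centralizerOrder_cons (m : ℕ) (s : Multiset ℕ) :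
    centralizerOrder (m ::ₘ s) = m * (s.count m + 1) * centralizerOrder s := by
  have hm : m ∈ insert m s.toFinset := Finset.mem_insert_self _ _
  rw [centralizerOrder, centralizerOrder, Multiset.prod_cons, Multiset.toFinset_cons,
    prod_factorial_count_eq s (Finset.subset_insert m s.toFinset),
    ← Finset.mul_prod_erase _ _ hm, ← Finset.mul_prod_erase _ _ hm, Multiset.count_cons_self,
    Nat.factorial_succ]
  have : ∏ x ∈ (insert m s.toFinset).erase m, (Multiset.count x (m ::ₘ s)).factorial =
      ∏ x ∈ (insert m s.toFinset).erase m, (Multiset.count x s).factorial :=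
    Finset.prod_congr rfl fun x hx => by
      rw [Multiset.count_cons_of_ne (Finset.ne_of_mem_erase hx)]
  rw [this]
  ring

theorem centralizerOrder_pos {s : Multiset ℕ} (hs : ∀ i ∈ s, 0 < i) : 0 < centralizerOrder s :=
  Nat.mul_pos (Multiset.prod_pos hs) (Finset.prod_pos fun _ _ => Nat.factorial_pos _)

/-- The number of permutations with a given cycle type. -/
theorem card_partition_eq_mul {α : Type*} [Fintype α] [DecidableEq α]
    (p : (Fintype.card α).Partition) :
    (Finset.univ.filter fun σ : Equiv.Perm α => σ.partition = p).card *
      centralizerOrder p.parts = (Fintype.card α).factorial := by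
  -- `cycleType` omits fixed points, so the parts equal to `1` are split off; they account for the
  -- factor `(card α - q.sum)!` in the count by cycle type.
  set q := p.parts.filter fun n => 2 ≤ n with hq
  set k := p.parts.count 1 with hk
  have hpq : p.parts = q + Multiset.replicate k 1 := by
    rw [hk, ← Multiset.filter_eq', hq]
    conv_lhs => rw [← Multiset.filter_add_not (fun n => 2 ≤ n) p.parts]
    congr 1
    refine Multiset.filter_congr fun x hx => ?_
    have := p.parts_pos hx
    omega
  have hsum : q.sum + k = Fintype.card α := by
    have := p.parts_sum
    rw [hpq] at this
    simpa using this
  have hset : (Finset.univ.filter fun σ : Equiv.Perm α => σ.partition = p) =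
      Finset.univ.filter fun σ : Equiv.Perm α => σ.cycleType = q := by
    refine Finset.filter_congr fun σ _ => ⟨fun h => ?_, fun h => ?_⟩
    · rw [hq, ← h, Equiv.Perm.filter_parts_partition_eq_cycleType]
    · rw [Nat.Partition.ext_iff, Equiv.Perm.parts_partition, ← Equiv.Perm.sum_cycleType, h, hpq,
        ← hsum, Nat.add_sub_cancel_left]
  have h := Equiv.Perm.card_of_cycleType_mul_eq (α := α) q
  rw [if_pos ⟨by omega, fun a ha => (Multiset.mem_filter.mp ha).2⟩] at h
  rw [hset, ← h]
  congr 1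
  have h1q : (1 : ℕ) ∉ q := by simp [hq]
  rw [centralizerOrder, prod_factorial_count_eq p.parts (t := insert 1 q.toFinset) (by
      rw [hpq]
      intro x hx
      simp only [Multiset.toFinset_add, Finset.mem_union, Multiset.mem_toFinset,
        Multiset.mem_replicate] at hx
      simp only [Finset.mem_insert, Multiset.mem_toFinset]
      tauto),
    Finset.prod_insert (by simpa using h1q), show Fintype.card α - q.sum = k by omega, ← hk]
  have h2 : ∏ i ∈ q.toFinset, (p.parts.count i).factorial =
      ∏ i ∈ q.toFinset, (q.count i).factorial :=
    Finset.prod_congr rfl fun x hx => by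
      have : x ≠ 1 := fun h => h1q (by simpa [h] using hx)
      rw [hpq, Multiset.count_add, Multiset.count_replicate, if_neg this.symm, add_zero]
  rw [h2, hpq, Multiset.prod_add, Multiset.prod_replicate, one_pow]
  ring

/-- The sum of a class function over the symmetric group. -/
theorem sum_perm_eq_sum_partition (n : ℕ) (F : Multiset ℕ → ℂ) :
    ((n.factorial : ℂ))⁻¹ * ∑ σ : Equiv.Perm (Fin n), F σ.partition.parts =
      ∑ p : n.Partition, F p.parts / (centralizerOrder p.parts : ℂ) := by
  have h : ((n.factorial : ℂ))⁻¹ * ∑ σ : Equiv.Perm (Fin n), F σ.partition.parts =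
      ∑ p : (Fintype.card (Fin n)).Partition, F p.parts / (centralizerOrder p.parts : ℂ) := by
    rw [← Finset.sum_fiberwise (s := Finset.univ)
      (g := fun σ : Equiv.Perm (Fin n) => σ.partition), Finset.mul_sum]
    refine Finset.sum_congr rfl fun p _ => ?_
    rw [Finset.sum_congr rfl (g := fun _ => F p.parts) (fun σ hσ => by
      rw [(Finset.mem_filter.mp hσ).2]), Finset.sum_const, nsmul_eq_mul]
    have hc := card_partition_eq_mul p
    have hpos : (centralizerOrder p.parts : ℂ) ≠ 0 := by
      exact_mod_cast (centralizerOrder_pos fun i hi => p.parts_pos hi).ne'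
    have hn : (n.factorial : ℂ) ≠ 0 := by exact_mod_cast n.factorial_ne_zero
    have hc' : ((Finset.univ.filter fun σ : Equiv.Perm (Fin n) => σ.partition = p).card : ℂ) *
      (centralizerOrder p.parts : ℂ) = (n.factorial : ℂ) := by
      have hc' := hc.trans (congrArg Nat.factorial (Fintype.card_fin n))
      exact_mod_cast hc'
    rw [inv_mul_eq_div, div_eq_div_iff hn hpos, ← hc']
    ring
  rw [h, Fintype.card_fin]

/-- The cycle index sum with weights `w`. -/
def partitionSum (w : ℕ → ℂ) (n : ℕ) : ℂ :=
  ∑ p : n.Partition, (p.parts.map w).prod / (centralizerOrder p.parts : ℂ)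

/-- Erasing one part `m` is a bijection from the partitions of `n` containing `m` onto the
partitions of `n - m`. The factor `m * count m` cancels exactly the change in the centralizer order,
leaving `w m`. -/
theorem sum_mul_count_partition (w : ℕ → ℂ) {n m : ℕ} (hm : 1 ≤ m) (hmn : m ≤ n) :
    ∑ p : n.Partition, ((m * p.parts.count m : ℕ) : ℂ) *
      ((p.parts.map w).prod / (centralizerOrder p.parts : ℂ)) = w m * partitionSum w (n - m) := by
  have h1 : ∑ p : n.Partition, ((m * p.parts.count m : ℕ) : ℂ) *
      ((p.parts.map w).prod / (centralizerOrder p.parts : ℂ)) =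
      ∑ p ∈ Finset.univ.filter (fun p : n.Partition => m ∈ p.parts),
        ((m * p.parts.count m : ℕ) : ℂ) *
          ((p.parts.map w).prod / (centralizerOrder p.parts : ℂ)) := by
    symm
    refine Finset.sum_filter_of_ne fun p _ hp => ?_
    by_contra hmem
    apply hp
    simp [Multiset.count_eq_zero.mpr hmem]
  rw [h1, ← Finset.sum_subtype_eq_sum_filter, Finset.subtype_univ, partitionSum, Finset.mul_sum]
  refine Fintype.sum_equiv (Nat.Partition.partitionWithPartEquiv hm hmn) _ _ fun p => ?_
  rw [Nat.Partition.partitionWithPartEquiv_apply_parts]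
  have hs := Multiset.cons_erase p.2
  set s := p.1.parts.erase m
  rw [← hs, centralizerOrder_cons, Multiset.count_cons_self, Multiset.map_cons,
    Multiset.prod_cons]
  have h1 : (m : ℂ) ≠ 0 := by exact_mod_cast (by omega : m ≠ 0)
  have h2 : ((s.count m : ℂ) + 1) ≠ 0 := by exact_mod_cast (s.count m).succ_ne_zero
  have h3 : (centralizerOrder s : ℂ) ≠ 0 := by
    exact_mod_cast (centralizerOrder_pos fun i hi =>
      p.1.parts_pos (Multiset.mem_of_mem_erase hi)).ne'
  push_cast
  field_simp

/-- The factor `n + 1` is the sum of the parts of each partition, written as `∑ k * count k`;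
exchanging the two sums reduces to the removal of one part. -/
theorem partitionSum_recurrence (w : ℕ → ℂ) (n : ℕ) :
    ((n : ℂ) + 1) * partitionSum w (n + 1) =
      ∑ k ∈ Finset.range (n + 1), w (k + 1) * partitionSum w (n - k) := by
  have h1 : ∀ k ∈ Finset.range (n + 1), w (k + 1) * partitionSum w (n - k) =
      ∑ p : (n + 1).Partition, (((k + 1) * p.parts.count (k + 1) : ℕ) : ℂ) *
        ((p.parts.map w).prod / (centralizerOrder p.parts : ℂ)) := by
    intro k hk
    rw [sum_mul_count_partition w (by omega) (by simpa using hk), Nat.add_sub_add_right]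
  rw [Finset.sum_congr rfl h1, Finset.sum_comm, partitionSum, Finset.mul_sum]
  refine Finset.sum_congr rfl fun p _ => ?_
  rw [← Finset.sum_mul]
  congr 1
  have h2 : ∑ k ∈ Finset.range (n + 1), (k + 1) * p.parts.count (k + 1) = n + 1 := by
    have h3 : ∑ k ∈ Finset.range (n + 2), p.parts.count k • k = p.parts.sum := by
      symm
      apply Finset.sum_multiset_count_of_subset
      intro x hx
      have := p.le_of_mem_parts (Multiset.mem_toFinset.mp hx)
      simp only [Finset.mem_range]
      omega
    rw [Finset.sum_range_succ', p.parts_sum] at h3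
    simpa [mul_comm] using h3
  exact_mod_cast h2.symm

theorem mk_partitionSum (w : ℕ → ℂ) :
    PowerSeries.mk (partitionSum w) =
      formalExp (PowerSeries.mk fun k => if k = 0 then 0 else w k / (k : ℂ)) := by
  refine mk_eq_formalExp_of_recurrence ?_ (partitionSum_recurrence w)
  simp [partitionSum, centralizerOrder]

/-! ### Tilted weights and the generating function identity -/

theorem prod_map_parts_eq {n : ℕ} (w : ℕ → ℂ) (σ : Equiv.Perm (Fin n)) :
    (σ.partition.parts.map w).prod = ∏ m ∈ Finset.Icc 1 n, w m ^ cycleCount m σ := by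
  rw [Finset.prod_multiset_map_count]
  refine Finset.prod_subset ?_ fun i _ hi => ?_
  · intro x hx
    have h1 := σ.partition.le_of_mem_parts (Multiset.mem_toFinset.mp hx)
    have h2 := σ.partition.parts_pos (Multiset.mem_toFinset.mp hx)
    rw [Fintype.card_fin] at h1
    simp only [Finset.mem_Icc]
    omega
  · rw [Multiset.count_eq_zero.mpr (by simpa using hi), pow_zero]

theorem cycleCount_eq_zero {n m : ℕ} (σ : Equiv.Perm (Fin n)) (hm : n < m) :
    cycleCount m σ = 0 := by
  refine Multiset.count_eq_zero.mpr fun h => ?_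
  have h1 := σ.partition.le_of_mem_parts h
  rw [Fintype.card_fin] at h1
  omega

/-- The tilted weights `θ_m e^{i s_m}` for `m ≤ b`, and `θ_m` otherwise. -/
def tiltedWeight (θ : ℕ → ℝ) (b : ℕ) (s : ℕ → ℝ) (m : ℕ) : ℂ :=
  (θ m : ℂ) * if m ∈ Finset.Icc 1 b then Complex.exp (Complex.I * (s m : ℂ)) else 1

theorem weight_mul_exp_eq (θ : ℕ → ℝ) {n : ℕ} (b : ℕ) (s : ℕ → ℝ) (σ : Equiv.Perm (Fin n)) :
    (weight θ σ : ℂ) *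
        Complex.exp (Complex.I * ∑ m ∈ Finset.Icc 1 b, (s m : ℂ) * (cycleCount m σ : ℂ)) =
      ∏ m ∈ Finset.Icc 1 n, tiltedWeight θ b s m ^ cycleCount m σ := by
  unfold tiltedWeight weight
  simp_rw [mul_pow]
  rw [Finset.prod_mul_distrib]
  push_cast
  congr 1
  rw [Finset.mul_sum, Complex.exp_sum]
  simp_rw [ite_pow, one_pow, ← Complex.exp_nat_mul]
  -- Since `b` may exceed `n`, the lengths `m > n` are separated; their cycle counts vanish.
  rw [← Finset.prod_filter, ← Finset.prod_filter_mul_prod_filter_not (Finset.Icc 1 b) (· ≤ n)]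
  rw [Finset.prod_eq_one (s := (Finset.Icc 1 b).filter fun x => ¬ x ≤ n), mul_one]
  · refine Finset.prod_congr ?_ fun x _ => ?_
    · ext x
      simp only [Finset.mem_filter, Finset.mem_Icc]
      tauto
    · congr 1
      ring
  · intro x hx
    rw [cycleCount_eq_zero σ (by simpa using (Finset.mem_filter.mp hx).2)]
    simp

theorem weight_nonneg {θ : ℕ → ℝ} (hθ : ∀ m : ℕ, 1 ≤ m → 0 ≤ θ m) {n : ℕ}
    (σ : Equiv.Perm (Fin n)) : 0 ≤ weight θ σ :=
  Finset.prod_nonneg fun m hm => pow_nonneg (hθ m (Finset.mem_Icc.mp hm).1) _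

theorem h_nonneg {θ : ℕ → ℝ} (hθ : ∀ m : ℕ, 1 ≤ m → 0 ≤ θ m) (n : ℕ) : 0 ≤ h θ n :=
  mul_nonneg (by positivity) (Finset.sum_nonneg fun σ _ => weight_nonneg hθ σ)

theorem h_mul_charFn {θ : ℕ → ℝ} (hθ : ∀ m : ℕ, 1 ≤ m → 0 ≤ θ m) (n b : ℕ) (s : ℕ → ℝ) :
    (h θ n : ℂ) * charFn θ n b s = partitionSum (tiltedWeight θ b s) n := by
  have hn : (n.factorial : ℝ) ≠ 0 := by exact_mod_cast n.factorial_ne_zero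
  have h1 : ∀ σ : Equiv.Perm (Fin n),
      h θ n * prob θ σ = (n.factorial : ℝ)⁻¹ * weight θ σ := by
    intro σ
    -- If `h θ n = 0`, nonnegativity forces every weight to vanish, so the identity survives the
    -- division by zero in `prob`.
    by_cases h0 : h θ n = 0
    · have hsum : ∑ σ : Equiv.Perm (Fin n), weight θ σ = 0 := by
        simpa [h, hn] using h0
      have := (Finset.sum_eq_zero_iff_of_nonneg fun σ _ => weight_nonneg hθ σ).mp hsum σ
        (Finset.mem_univ _)
      simp [h0, this]
    · unfold prob
      field_simp
  rw [partitionSum, ← sum_perm_eq_sum_partition n fun t => (t.map (tiltedWeight θ b s)).prod,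
    charFn, expectation, Finset.mul_sum, Finset.mul_sum]
  refine Finset.sum_congr rfl fun σ _ => ?_
  rw [prod_map_parts_eq, ← weight_mul_exp_eq, ← mul_assoc, ← mul_assoc]
  congr 1
  rw [← Complex.ofReal_mul, h1 σ]
  push_cast
  rfl

theorem constantCoeff_gSeries (θ : ℕ → ℝ) : PowerSeries.constantCoeff (gSeries θ) = 0 := by
  simp [gSeries, ← PowerSeries.coeff_zero_eq_constantCoeff_apply]

theorem coeff_cycleSeries (θ : ℕ → ℝ) (b : ℕ) (s : ℕ → ℝ) (n : ℕ) :
    PowerSeries.coeff n (cycleSeries θ b s) =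
      if n ∈ Finset.Icc 1 b then
        (θ n : ℂ) / (n : ℂ) * (Complex.exp (Complex.I * (s n : ℂ)) - 1) else 0 := by
  rw [cycleSeries, map_sum]
  simp_rw [PowerSeries.coeff_C_mul, PowerSeries.coeff_X_pow, mul_ite, mul_one, mul_zero]
  rw [Finset.sum_ite_eq]

theorem constantCoeff_cycleSeries (θ : ℕ → ℝ) (b : ℕ) (s : ℕ → ℝ) :
    PowerSeries.constantCoeff (cycleSeries θ b s) = 0 := by
  rw [← PowerSeries.coeff_zero_eq_constantCoeff_apply, coeff_cycleSeries]
  simp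

/-- Writing `θ_m e^{i s_m} = θ_m + θ_m (e^{i s_m} - 1)` splits the exponent of the cycle index
series into `gSeries` and `cycleSeries`. -/
theorem mk_h_mul_charFn {θ : ℕ → ℝ} (hθ : ∀ m : ℕ, 1 ≤ m → 0 ≤ θ m) (b : ℕ) (s : ℕ → ℝ) :
    PowerSeries.mk (fun n : ℕ => (h θ n : ℂ) * charFn θ n b s) =
      formalExp (cycleSeries θ b s) * GSeries θ := by
  simp_rw [h_mul_charFn hθ]
  rw [GSeries, ← formalExp_add (constantCoeff_cycleSeries θ b s) (constantCoeff_gSeries θ),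
    mk_partitionSum]
  congr 1
  ext n
  rw [map_add, coeff_cycleSeries, gSeries, PowerSeries.coeff_mk, PowerSeries.coeff_mk, tiltedWeight]
  rcases Nat.eq_zero_or_pos n with rfl | hn
  · simp
  · rw [if_neg hn.ne', if_neg hn.ne']
    split_ifs <;> ring

/-! ### Taylor series as formal power series -/

/-- The Taylor series of `f` at `0`. -/
def taylorSeries (f : ℂ → ℂ) : PowerSeries ℂ :=
  PowerSeries.mk fun n => iteratedDeriv n f 0 / (n.factorial : ℂ)

theorem coeff_taylorSeries (f : ℂ → ℂ) (n : ℕ) :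
    PowerSeries.coeff n (taylorSeries f) = iteratedDeriv n f 0 / (n.factorial : ℂ) :=
  PowerSeries.coeff_mk _ _

theorem constantCoeff_taylorSeries (f : ℂ → ℂ) :
    PowerSeries.constantCoeff (taylorSeries f) = f 0 := by
  simp [← PowerSeries.coeff_zero_eq_constantCoeff_apply, coeff_taylorSeries]

theorem taylorSeries_congr {f g : ℂ → ℂ} (h : f =ᶠ[𝓝 0] g) :
    taylorSeries f = taylorSeries g := by
  ext n
  rw [coeff_taylorSeries, coeff_taylorSeries, h.iteratedDeriv_eq]

theorem hasFPowerSeriesAt_of_hasSum {f : ℂ → ℂ} {a : ℕ → ℂ}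
    (h : ∀ᶠ t in 𝓝 (0 : ℂ), HasSum (fun n : ℕ => a n * t ^ n) (f t)) :
    HasFPowerSeriesAt f (FormalMultilinearSeries.ofScalars ℂ a) 0 := by
  rw [hasFPowerSeriesAt_iff]
  filter_upwards [h] with t ht
  simpa [FormalMultilinearSeries.coeff_ofScalars, mul_comm] using ht

theorem taylorSeries_eq_of_hasSum {f : ℂ → ℂ} {g : PowerSeries ℂ}
    (h : ∀ᶠ t in 𝓝 (0 : ℂ), HasSum (fun n : ℕ => PowerSeries.coeff n g * t ^ n) (f t)) :
    taylorSeries f = g := by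
  have h1 := hasFPowerSeriesAt_of_hasSum h
  have h2 := h1.eq_formalMultilinearSeries h1.analyticAt.hasFPowerSeriesAt
  ext n
  have h3 := congrArg (fun p => FormalMultilinearSeries.coeff p n) h2
  simp only [FormalMultilinearSeries.coeff_ofScalars] at h3
  rw [coeff_taylorSeries, h3]

theorem taylorSeries_add {f g : ℂ → ℂ} (hf : AnalyticAt ℂ f 0) (hg : AnalyticAt ℂ g 0) :
    taylorSeries (fun t => f t + g t) = taylorSeries f + taylorSeries g := by
  ext n
  rw [map_add]
  simp only [coeff_taylorSeries]
  rw [iteratedDeriv_fun_add hf.contDiffAt hg.contDiffAt, add_div]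

theorem taylorSeries_mul {f g : ℂ → ℂ} (hf : AnalyticAt ℂ f 0) (hg : AnalyticAt ℂ g 0) :
    taylorSeries (fun t => f t * g t) = taylorSeries f * taylorSeries g := by
  ext n
  rw [PowerSeries.coeff_mul, Finset.Nat.sum_antidiagonal_eq_sum_range_succ_mk]
  simp only [coeff_taylorSeries]
  rw [iteratedDeriv_fun_mul hf.contDiffAt hg.contDiffAt, Finset.sum_div]
  refine Finset.sum_congr rfl fun i hi => ?_
  have hin : i ≤ n := by simpa [Nat.lt_succ_iff] using hi
  rw [Nat.cast_choose ℂ hin]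
  have h1 : (n.factorial : ℂ) ≠ 0 := by exact_mod_cast n.factorial_ne_zero
  have h2 : (i.factorial : ℂ) ≠ 0 := by exact_mod_cast i.factorial_ne_zero
  have h3 : ((n - i).factorial : ℂ) ≠ 0 := by exact_mod_cast (n - i).factorial_ne_zero
  field_simp

theorem taylorSeries_const (c : ℂ) : taylorSeries (fun _ => c) = PowerSeries.C c := by
  ext n
  rw [coeff_taylorSeries, iteratedDeriv_const, PowerSeries.coeff_C]
  split_ifs with h
  · simp [h]
  · simp

theorem taylorSeries_deriv (f : ℂ → ℂ) :
    taylorSeries (deriv f) = PowerSeries.derivative ℂ (taylorSeries f) := by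
  ext n
  rw [PowerSeries.coeff_derivative, coeff_taylorSeries, coeff_taylorSeries, ← iteratedDeriv_succ',
    Nat.factorial_succ]
  have h1 : (n.factorial : ℂ) ≠ 0 := by exact_mod_cast n.factorial_ne_zero
  have h2 : ((n : ℂ) + 1) ≠ 0 := by exact_mod_cast n.succ_ne_zero
  push_cast
  field_simp

/-- The analytic exponential satisfies the same differential equation as the formal one, and
`taylorSeries` respects derivatives and products. -/
theorem taylorSeries_exp {f : ℂ → ℂ} (hf : AnalyticAt ℂ f 0) (h0 : f 0 = 0) :
    taylorSeries (fun t => Complex.exp (f t)) = formalExp (taylorSeries f) := by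
  have hc : PowerSeries.constantCoeff (taylorSeries f) = 0 := by
    rw [constantCoeff_taylorSeries, h0]
  have hE : AnalyticAt ℂ (fun t => Complex.exp (f t)) 0 := hf.cexp
  have h1 : deriv (fun t => Complex.exp (f t)) =ᶠ[𝓝 0] fun t => deriv f t * Complex.exp (f t) := by
    filter_upwards [hf.eventually_analyticAt] with t ht
    rw [(ht.differentiableAt.hasDerivAt.cexp).deriv, mul_comm]
  have := eq_C_mul_formalExp (E := taylorSeries (fun t => Complex.exp (f t))) hc (by
    rw [← taylorSeries_deriv, ← taylorSeries_deriv, taylorSeries_congr h1,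
      taylorSeries_mul hf.deriv hE])
  rw [this, constantCoeff_taylorSeries, h0]
  simp

/-- Cauchy's estimate with the mean over the circle kept: a maximum would lose a factor `n` near a
boundary singularity of order above `1`. -/
theorem norm_coeff_taylorSeries_le {f : ℂ → ℂ} {ρ : ℝ} (hρ : 0 < ρ)
    (hf : DifferentiableOn ℂ f (Metric.closedBall 0 ρ)) (n : ℕ) :
    ‖PowerSeries.coeff n (taylorSeries f)‖ ≤
      ((2 * Real.pi)⁻¹ * ∫ x in (0 : ℝ)..2 * Real.pi, ‖f (circleMap 0 ρ x)‖) * ρ⁻¹ ^ n := by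
  lift ρ to NNReal using hρ.le
  have h1 := hf.hasFPowerSeriesOnBall (by exact_mod_cast hρ)
  have h2 := h1.hasFPowerSeriesAt.analyticAt.hasFPowerSeriesAt
  have h3 := h1.hasFPowerSeriesAt.eq_formalMultilinearSeries h2
  have h4 := norm_cauchyPowerSeries_le f 0 ρ n
  rw [h3, FormalMultilinearSeries.norm_apply_eq_norm_coef,
    FormalMultilinearSeries.coeff_ofScalars, abs_of_pos hρ] at h4
  rwa [coeff_taylorSeries]

/-! ### The singular factor `(1 - t/r)^(-θ)` and its logarithm -/

/-- The coefficients of `(1 - t)^(-θ)`. -/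
def risingBinom (θ : ℝ) (n : ℕ) : ℝ :=
  ∏ j ∈ Finset.range n, (θ + j) / (j + 1)

theorem risingBinom_zero (θ : ℝ) : risingBinom θ 0 = 1 := by simp [risingBinom]

theorem succ_mul_risingBinom_succ (θ : ℝ) (n : ℕ) :
    ((n : ℝ) + 1) * risingBinom θ (n + 1) = (θ + n) * risingBinom θ n := by
  have : (n : ℝ) + 1 ≠ 0 := by positivity
  rw [risingBinom, Finset.prod_range_succ, ← risingBinom]
  field_simp

theorem risingBinom_pos {θ : ℝ} (hθ : 0 < θ) (n : ℕ) : 0 < risingBinom θ n :=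
  Finset.prod_pos fun j _ => by positivity

/-- Partial sums are the coefficients of `(1 - t)^(-θ-1)`. This yields the recurrence behind
`formalExp_logSeries` and, later, a bound for partial sums. -/
theorem mul_sum_risingBinom (θ : ℝ) (n : ℕ) :
    θ * ∑ j ∈ Finset.range (n + 1), risingBinom θ j = (θ + n) * risingBinom θ n := by
  induction n with
  | zero => simp
  | succ n ih =>
    rw [Finset.sum_range_succ, mul_add, ih, ← succ_mul_risingBinom_succ]
    push_cast
    ring

/-- The Taylor series of `θ log (1 / (1 - t / r))`. -/
def logSeries (r θ : ℝ) : PowerSeries ℂ :=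
  PowerSeries.mk fun k => if k = 0 then 0 else ((θ : ℂ) * ((r : ℂ) ^ k)⁻¹) / (k : ℂ)

theorem constantCoeff_logSeries (r θ : ℝ) :
    PowerSeries.constantCoeff (logSeries r θ) = 0 := by
  simp [logSeries, ← PowerSeries.coeff_zero_eq_constantCoeff_apply]

theorem formalExp_logSeries (r θ : ℝ) :
    formalExp (logSeries r θ) =
      PowerSeries.mk fun n => (risingBinom θ n : ℂ) * ((r : ℂ) ^ n)⁻¹ := by
  symm
  refine mk_eq_formalExp_of_recurrence (by simp [risingBinom_zero]) fun n => ?_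
  have h1 : ∀ k ∈ Finset.range (n + 1),
      (θ : ℂ) * ((r : ℂ) ^ (k + 1))⁻¹ * ((risingBinom θ (n - k) : ℂ) * ((r : ℂ) ^ (n - k))⁻¹) =
      (θ : ℂ) * (risingBinom θ (n - k) : ℂ) * ((r : ℂ) ^ (n + 1))⁻¹ := by
    intro k hk
    have hk' : k ≤ n := by simpa [Nat.lt_succ_iff] using hk
    rw [show n + 1 = (k + 1) + (n - k) by omega, pow_add, mul_inv]
    ring
  rw [Finset.sum_congr rfl h1, ← Finset.sum_mul, ← Finset.mul_sum, ← mul_assoc]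
  congr 1
  have h3 := Finset.sum_range_reflect (fun j => (risingBinom θ j : ℂ)) (n + 1)
  simp only [Nat.add_sub_cancel] at h3
  rw [h3]
  have h2 := succ_mul_risingBinom_succ θ n
  rw [← mul_sum_risingBinom] at h2
  exact_mod_cast h2

theorem norm_div_lt_one {r : ℝ} {t : ℂ} (ht : ‖t‖ < r) : ‖t / (r : ℂ)‖ < 1 := by
  have hr : 0 < r := (norm_nonneg t).trans_lt ht
  rw [norm_div, Complex.norm_real, Real.norm_of_nonneg hr.le, div_lt_one hr]
  exact ht

theorem one_sub_mem_slitPlane {z : ℂ} (hz : ‖z‖ < 1) : 1 - z ∈ Complex.slitPlane := by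
  rw [sub_eq_add_neg]
  exact Complex.mem_slitPlane_of_norm_lt_one (by simpa using hz)

theorem log_one_div_one_sub {z : ℂ} (hz : 1 - z ∈ Complex.slitPlane) :
    Complex.log (1 / (1 - z)) = -Complex.log (1 - z) := by
  rw [one_div, Complex.log_inv _ (Complex.slitPlane_arg_ne_pi hz)]

theorem hasSum_logSeries {r : ℝ} (θ : ℝ) {t : ℂ} (ht : ‖t‖ < r) :
    HasSum (fun n : ℕ => PowerSeries.coeff n (logSeries r θ) * t ^ n)
      ((θ : ℂ) * Complex.log (1 / (1 - t / (r : ℂ)))) := by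
  have h1 := norm_div_lt_one ht
  rw [log_one_div_one_sub (one_sub_mem_slitPlane h1)]
  refine ((Complex.hasSum_taylorSeries_neg_log h1).mul_left (θ : ℂ)).congr_fun ?_
  intro n
  rw [logSeries, PowerSeries.coeff_mk, div_pow]
  rcases Nat.eq_zero_or_pos n with rfl | hn
  · simp
  · rw [if_neg hn.ne']
    ring

theorem taylorSeries_log {r : ℝ} (hr : 0 < r) (θ : ℝ) :
    taylorSeries (fun t => (θ : ℂ) * Complex.log (1 / (1 - t / (r : ℂ)))) = logSeries r θ := by
  refine taylorSeries_eq_of_hasSum ?_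
  filter_upwards [Metric.ball_mem_nhds (0 : ℂ) hr] with t ht
  exact hasSum_logSeries θ (by simpa using ht)

theorem differentiableAt_log_one_div {z w : ℂ} (h : 1 - z / w ∈ Complex.slitPlane) :
    DifferentiableAt ℂ (fun t => Complex.log (1 / (1 - t / w))) z := by
  have hc : ContinuousAt (fun t : ℂ => 1 - t / w) z := by fun_prop
  have h1 : DifferentiableAt ℂ (fun t => -Complex.log (1 - t / w)) z :=
    (DifferentiableAt.clog (f := fun t : ℂ => 1 - t / w) (by fun_prop) h).fun_neg
  refine h1.congr_of_eventuallyEq ?_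
  filter_upwards [hc.eventually_mem (Complex.isOpen_slitPlane.mem_nhds h)] with t ht
  exact log_one_div_one_sub ht

/-! ### From coefficient estimates to characteristic functions -/

theorem norm_limitCharFn_le_one {θ : ℕ → ℝ} (hθ : ∀ m : ℕ, 1 ≤ m → 0 ≤ θ m) {r : ℝ} (hr : 0 ≤ r)
    (b : ℕ) (s : ℕ → ℝ) : ‖limitCharFn θ r b s‖ ≤ 1 := by
  rw [limitCharFn, Complex.norm_exp, Real.exp_le_one_iff, Complex.re_sum]
  refine Finset.sum_nonpos fun m hm => ?_
  have h1 : (θ m : ℂ) / (m : ℂ) * (Complex.exp (Complex.I * (s m : ℂ)) - 1) * (r : ℂ) ^ m =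
      ((θ m / m * r ^ m : ℝ) : ℂ) * (Complex.exp ((s m : ℂ) * Complex.I) - 1) := by
    rw [mul_comm Complex.I]
    push_cast
    ring
  rw [h1, Complex.re_ofReal_mul, Complex.sub_re, Complex.exp_ofReal_mul_I_re, Complex.one_re]
  have h2 := hθ m (Finset.mem_Icc.mp hm).1
  exact mul_nonpos_of_nonneg_of_nonpos (by positivity) (by linarith [Real.cos_le_one (s m)])

theorem h_mul_charFn_zero (θ : ℕ → ℝ) (n b : ℕ) :
    (h θ n : ℂ) * charFn θ n b 0 = h θ n := by
  by_cases h0 : h θ n = 0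
  · simp [h0]
  · have h1 := sum_prob θ h0
    have h2 : charFn θ n b 0 = 1 := by
      simp only [charFn, expectation, Pi.zero_apply, Complex.ofReal_zero, zero_mul,
        Finset.sum_const_zero, mul_zero, Complex.exp_zero, mul_one]
      exact_mod_cast h1
    rw [h2, mul_one]

theorem limitCharFn_zero (θ : ℕ → ℝ) (r : ℝ) (b : ℕ) : limitCharFn θ r b 0 = 1 := by
  simp [limitCharFn]

/-- At `s = 0` the hypothesis says `h_n r^n ≈ S p_n`, which gives positivity and the lower bound
`‖S‖ p_n / 2`. Dividing the estimate at `s` by this one removes both `S` and `p_n`. -/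
theorem charFn_estimate_of_coeff_estimate {θ : ℕ → ℝ} (hθ : ∀ m : ℕ, 1 ≤ m → 0 ≤ θ m) {r : ℝ}
    (hr : 0 < r) (b : ℕ) {S : ℂ} (hS : S ≠ 0) {p ε : ℕ → ℝ} (hp : ∀ n, 0 < p n)
    (hε : Tendsto ε atTop (𝓝 0)) {C : ℝ}
    (hC : ∀ᶠ n : ℕ in atTop, ∀ s : ℕ → ℝ,
      ‖(h θ n : ℂ) * charFn θ n b s * (r : ℂ) ^ n - S * limitCharFn θ r b s * (p n : ℂ)‖ ≤
        C * p n * ε n) :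
    ∃ A : ℝ, ∀ᶠ n : ℕ in atTop, 0 < h θ n ∧ ∀ s : ℕ → ℝ,
      ‖charFn θ n b s - limitCharFn θ r b s‖ ≤ A * ε n := by
  have hS' : 0 < ‖S‖ := norm_pos_iff.mpr hS
  have hsmall : ∀ᶠ n : ℕ in atTop, C * ε n < ‖S‖ / 2 := by
    have h1 : Tendsto (fun n => C * ε n) atTop (𝓝 0) := by simpa using hε.const_mul C
    exact h1.eventually_lt_const (by positivity)
  -- Two errors `C p_n ε_n`, at `s` and at `0`, divided by `‖S‖ p_n / 2`.
  refine ⟨4 * C / ‖S‖, ?_⟩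
  filter_upwards [hC, hsmall] with n hn hns
  have hpn := hp n
  have h0 := hn 0
  rw [h_mul_charFn_zero, limitCharFn_zero, mul_one] at h0
  have hhn := h_nonneg hθ n
  have hrn : 0 < r ^ n := by positivity
  have h1 : ‖S‖ * p n / 2 ≤ h θ n * r ^ n := by
    have h2 : ‖S * (p n : ℂ)‖ ≤ ‖(h θ n : ℂ) * (r : ℂ) ^ n‖ + C * p n * ε n := by
      refine (norm_le_norm_add_norm_sub' _ ((h θ n : ℂ) * (r : ℂ) ^ n)).trans ?_
      rw [norm_sub_rev]
      gcongr
    rw [norm_mul, norm_mul, norm_pow, Complex.norm_real, Complex.norm_real, Complex.norm_real,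
      Real.norm_of_nonneg hpn.le, Real.norm_of_nonneg hhn, Real.norm_of_nonneg hr.le] at h2
    nlinarith [mul_lt_mul_of_pos_left hns hpn]
  have h2 : 0 < h θ n * r ^ n := lt_of_lt_of_le (by positivity) h1
  refine ⟨pos_of_mul_pos_left h2 hrn.le, fun s => ?_⟩
  have h3 := hn s
  have hid : ((h θ n * r ^ n : ℝ) : ℂ) * (charFn θ n b s - limitCharFn θ r b s) =
      ((h θ n : ℂ) * charFn θ n b s * (r : ℂ) ^ n - S * limitCharFn θ r b s * (p n : ℂ)) -
        limitCharFn θ r b s * ((h θ n : ℂ) * (r : ℂ) ^ n - S * (p n : ℂ)) := by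
    push_cast
    ring
  have h4 : (h θ n * r ^ n) * ‖charFn θ n b s - limitCharFn θ r b s‖ ≤ 2 * (C * p n * ε n) := by
    rw [← Real.norm_of_nonneg h2.le, ← Complex.norm_real, ← norm_mul, hid]
    refine (norm_sub_le _ _).trans ?_
    rw [norm_mul]
    have := mul_le_mul (norm_limitCharFn_le_one hθ hr.le b s) h0 (norm_nonneg _) zero_le_one
    linarith
  have h5 : (‖S‖ * p n / 2) * ‖charFn θ n b s - limitCharFn θ r b s‖ ≤ 2 * (C * p n * ε n) :=
    (mul_le_mul_of_nonneg_right h1 (norm_nonneg _)).trans h4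
  have h6 : 4 * C / ‖S‖ * ε n = 2 * (C * p n * ε n) / (‖S‖ * p n / 2) := by
    field_simp
    ring
  rw [h6, le_div_iff₀ (by positivity)]
  linarith

/-! ### Polynomially decaying coefficients under the formal exponential -/

/-- The decay profile `(n + 1)^(-δ)`. -/
def decay (δ : ℝ) (n : ℕ) : ℝ := ((n : ℝ) + 1) ^ (-δ)

theorem decay_pos (δ : ℝ) (n : ℕ) : 0 < decay δ n := by
  unfold decay
  positivity

theorem summable_decay {δ : ℝ} (hδ : 1 < δ) : Summable (decay δ) := by
  have h1 := (summable_nat_add_iff 1).mpr (Real.summable_nat_rpow.mpr (by linarith : -δ < -1))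
  refine h1.congr fun n => ?_
  simp [decay]

/-- In each product one index is at least `n / 2`, and its factor is at most `2 ^ δ * decay δ n`;
the other factor is summable. -/
theorem exists_sum_decay_mul_decay_le {δ : ℝ} (hδ : 1 < δ) :
    ∃ Q : ℝ, 0 ≤ Q ∧ ∀ n : ℕ,
      ∑ ij ∈ Finset.HasAntidiagonal.antidiagonal n, decay δ ij.1 * decay δ ij.2 ≤ Q * decay δ n := by
  have hs := summable_decay hδ
  have hT : 0 ≤ ∑' n, decay δ n := tsum_nonneg fun n => (decay_pos δ n).le
  refine ⟨2 ^ δ * (2 * ∑' n, decay δ n), by positivity, fun n => ?_⟩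
  have hhalf : ∀ i : ℕ, n ≤ 2 * i + 1 → decay δ i ≤ 2 ^ δ * decay δ n := by
    intro i hi
    have hi' : (n : ℝ) ≤ 2 * i + 1 := by exact_mod_cast hi
    unfold decay
    calc ((i : ℝ) + 1) ^ (-δ) ≤ (((n : ℝ) + 1) / 2) ^ (-δ) :=
          Real.rpow_le_rpow_of_nonpos (by positivity) (by linarith) (by linarith)
      _ = 2 ^ δ * ((n : ℝ) + 1) ^ (-δ) := by
          rw [Real.div_rpow (by positivity) (by norm_num), Real.rpow_neg (by norm_num : (0:ℝ) ≤ 2),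
            div_inv_eq_mul, mul_comm]
  have h1 : ∀ ij ∈ Finset.HasAntidiagonal.antidiagonal n, decay δ ij.1 * decay δ ij.2 ≤
      2 ^ δ * decay δ n * (decay δ ij.1 + decay δ ij.2) := by
    rintro ⟨i, j⟩ hij
    have hij' := Finset.HasAntidiagonal.mem_antidiagonal.mp hij
    simp only at hij' ⊢
    have hi := decay_pos δ i
    have hj := decay_pos δ j
    have hn := decay_pos δ n
    have h2 : (0 : ℝ) < 2 ^ δ := by positivity
    rcases le_total i j with h | h
    · have := hhalf j (by omega)
      nlinarith [mul_pos (mul_pos h2 hn) hj]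
    · have := hhalf i (by omega)
      nlinarith [mul_pos (mul_pos h2 hn) hi]
  refine (Finset.sum_le_sum h1).trans ?_
  rw [← Finset.mul_sum, Finset.sum_add_distrib]
  have h3 : ∑ ij ∈ Finset.HasAntidiagonal.antidiagonal n, decay δ ij.1 ≤ ∑' n, decay δ n := by
    rw [Finset.Nat.sum_antidiagonal_eq_sum_range_succ_mk]
    exact hs.sum_le_tsum _ fun i _ => (decay_pos δ i).le
  have h4 : ∑ ij ∈ Finset.HasAntidiagonal.antidiagonal n, decay δ ij.2 =
      ∑ ij ∈ Finset.HasAntidiagonal.antidiagonal n, decay δ ij.1 := Finset.Nat.sum_antidiagonal_swap (f := fun ij => decay δ ij.1)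
  rw [h4]
  have h5 : 0 ≤ 2 ^ δ * decay δ n := mul_nonneg (by positivity) (decay_pos δ n).le
  calc _ ≤ 2 ^ δ * decay δ n * (∑' n, decay δ n + ∑' n, decay δ n) := by gcongr
    _ = _ := by ring

open PowerSeries in
theorem norm_coeff_pow_le {δ Q U : ℝ} (hU : 0 ≤ U)
    (hQ : ∀ n : ℕ,
      ∑ ij ∈ Finset.HasAntidiagonal.antidiagonal n, decay δ ij.1 * decay δ ij.2 ≤ Q * decay δ n)
    (hQ0 : 0 ≤ Q) {u : PowerSeries ℂ} (hu : ∀ n, ‖coeff n u‖ ≤ U * decay δ n) (k n : ℕ) :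
    ‖coeff n (u ^ k)‖ ≤ (Q * U) ^ k * decay δ n := by
  induction k generalizing n with
  | zero =>
    rw [pow_zero, coeff_one]
    split_ifs with h
    · simp [h, decay]
    · simpa using (decay_pos δ n).le
  | succ k ih =>
    rw [pow_succ, coeff_mul]
    refine (norm_sum_le _ _).trans ?_
    calc ∑ ij ∈ Finset.HasAntidiagonal.antidiagonal n, ‖coeff ij.1 (u ^ k) * coeff ij.2 u‖
        ≤ ∑ ij ∈ Finset.HasAntidiagonal.antidiagonal n,
            ((Q * U) ^ k * U) * (decay δ ij.1 * decay δ ij.2) := by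
          refine Finset.sum_le_sum fun ij _ => ?_
          rw [norm_mul]
          calc _ ≤ ((Q * U) ^ k * decay δ ij.1) * (U * decay δ ij.2) :=
                mul_le_mul (ih _) (hu _) (norm_nonneg _)
                  (mul_nonneg (by positivity) (decay_pos _ _).le)
            _ = _ := by ring
      _ ≤ ((Q * U) ^ k * U) * (Q * decay δ n) := by
          rw [← Finset.mul_sum]
          exact mul_le_mul_of_nonneg_left (hQ n) (by positivity)
      _ = _ := by ring

-- The powers of `u` grow at most geometrically in this norm, so the factorials sum them. The
-- constant depends on `u` only through `U`, which makes the later bounds uniform in `s`.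
open PowerSeries in
theorem norm_coeff_formalExp_le {δ Q U : ℝ} (hU : 0 ≤ U)
    (hQ : ∀ n : ℕ,
      ∑ ij ∈ Finset.HasAntidiagonal.antidiagonal n, decay δ ij.1 * decay δ ij.2 ≤ Q * decay δ n)
    (hQ0 : 0 ≤ Q) {u : PowerSeries ℂ} (hu0 : constantCoeff u = 0)
    (hu : ∀ n, ‖coeff n u‖ ≤ U * decay δ n) (n : ℕ) :
    ‖coeff n (formalExp u)‖ ≤ Real.exp (Q * U) * decay δ n := by
  rw [coeff_formalExp hu0]
  refine (norm_sum_le _ _).trans ?_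
  calc _ ≤ ∑ k ∈ Finset.range (n + 1), ((Q * U) ^ k / k.factorial) * decay δ n := by
        refine Finset.sum_le_sum fun k _ => ?_
        rw [norm_mul, norm_inv, Complex.norm_natCast, inv_mul_eq_div, div_mul_eq_mul_div]
        gcongr
        exact norm_coeff_pow_le hU hQ hQ0 hu k n
    _ ≤ _ := by
        rw [← Finset.sum_mul]
        exact mul_le_mul_of_nonneg_right (Real.sum_le_exp_of_nonneg (by positivity) _)
          (decay_pos _ _).le

open PowerSeries in
theorem hasSum_coeff_pow {u : PowerSeries ℂ} (hu : Summable fun n => ‖coeff n u‖) (k : ℕ) :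
    (Summable fun n => ‖coeff n (u ^ k)‖) ∧
      ∑' n, coeff n (u ^ k) = (∑' n, coeff n u) ^ k := by
  induction k with
  | zero =>
    have h1 : ∀ n : ℕ, n ∉ ({0} : Finset ℕ) → coeff n (u ^ 0) = 0 := by
      intro n hn
      rw [pow_zero, coeff_one, if_neg (by simpa using hn)]
    refine ⟨summable_of_ne_finset_zero (s := {0}) fun n hn => by rw [h1 n hn, norm_zero], ?_⟩
    rw [tsum_eq_sum h1]
    simp
  | succ k ih =>
    have h1 : ∀ n, coeff n (u ^ (k + 1)) =
        ∑ ij ∈ Finset.HasAntidiagonal.antidiagonal n, coeff ij.1 (u ^ k) * coeff ij.2 u := fun n => by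
      rw [pow_succ, coeff_mul]
    have h2 := summable_norm_sum_mul_antidiagonal_of_summable_norm
      (f := fun n => coeff n (u ^ k)) (g := fun n => coeff n u) ih.1 hu
    have h3 := tsum_mul_tsum_eq_tsum_sum_antidiagonal_of_summable_norm
      (f := fun n => coeff n (u ^ k)) (g := fun n => coeff n u) ih.1 hu
    refine ⟨h2.congr fun n => by rw [h1], ?_⟩
    rw [tsum_congr h1, ← h3, ih.2, pow_succ]

-- Evaluation at the boundary point `1`: the decay makes the double series absolutely convergent, so
-- the sums can be exchanged.
open PowerSeries in
theorem tsum_coeff_formalExp {δ U : ℝ} (hδ : 1 < δ) (hU : 0 ≤ U)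
    {u : PowerSeries ℂ} (hu0 : constantCoeff u = 0) (hu : ∀ n, ‖coeff n u‖ ≤ U * decay δ n) :
    ∑' n, coeff n (formalExp u) = Complex.exp (∑' n, coeff n u) := by
  obtain ⟨Q, hQ0, hQ⟩ := exists_sum_decay_mul_decay_le hδ
  have hdec := summable_decay hδ
  have hus : Summable fun n => ‖coeff n u‖ :=
    Summable.of_nonneg_of_le (fun _ => norm_nonneg _) hu (hdec.mul_left U)
  have h1 : ∀ n, coeff n (formalExp u) = ∑' k : ℕ, ((k.factorial : ℂ))⁻¹ * coeff n (u ^ k) := by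
    intro n
    rw [coeff_formalExp hu0, tsum_eq_sum]
    intro k hk
    have : coeff n (u ^ k) = 0 := coeff_of_lt_order _
      (lt_of_lt_of_le (by simpa using hk) (le_order_pow_of_constantCoeff_eq_zero k hu0))
    rw [this, mul_zero]
  have hsum : Summable (Function.uncurry fun k n : ℕ =>
      ((k.factorial : ℂ))⁻¹ * coeff n (u ^ k)) := by
    have h2 : Summable fun x : ℕ × ℕ => ((Q * U) ^ x.1 / x.1.factorial) * decay δ x.2 :=
      (Real.summable_pow_div_factorial (Q * U)).mul_of_nonneg hdec
        (fun k => by positivity) (fun n => (decay_pos δ n).le)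
    refine Summable.of_norm_bounded h2 ?_
    rintro ⟨k, n⟩
    simp only [Function.uncurry]
    rw [norm_mul, norm_inv, Complex.norm_natCast, inv_mul_eq_div, div_mul_eq_mul_div]
    gcongr
    exact norm_coeff_pow_le hU hQ hQ0 hu k n
  simp_rw [h1]
  rw [hsum.tsum_comm]
  simp_rw [tsum_mul_left, (hasSum_coeff_pow hus _).2]
  rw [Complex.exp_eq_exp_ℂ, NormedSpace.exp_eq_tsum ℂ]
  simp

/-! ### Convolution with the coefficients of `(1 - t)^(-θ)` -/

theorem mul_risingBinom_le {θ : ℝ} (hθ : 0 < θ) {j n : ℕ} (hjn : j ≤ n) :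
    (j : ℝ) * risingBinom θ j ≤ n * risingBinom θ n := by
  refine monotone_nat_of_le_succ (f := fun n : ℕ => (n : ℝ) * risingBinom θ n) (fun n => ?_) hjn
  have h1 := succ_mul_risingBinom_succ θ n
  have h2 := risingBinom_pos hθ n
  push_cast
  rw [h1]
  nlinarith

/-- Telescoping: consecutive terms differ by `|θ - 1| p_j / (j + 1)`. For `j ≥ n / 2`, monotonicity
of `n p_n` gives `p_j ≤ 2 p_n`, so each step costs at most `4 |θ - 1| p_n / n`. -/
theorem abs_risingBinom_sub_le {θ : ℝ} (hθ : 0 < θ) {k n : ℕ} (hkn : 2 * k ≤ n) :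
    |risingBinom θ (n - k) - risingBinom θ n| ≤ 4 * |θ - 1| * k * (risingBinom θ n / n) := by
  induction k with
  | zero => simp
  | succ k ih =>
    have ih := ih (by omega)
    obtain ⟨j, hj⟩ : ∃ j, n - k = j + 1 := ⟨n - k - 1, by omega⟩
    have hj' : n - (k + 1) = j := by omega
    rw [hj] at ih
    rw [hj']
    have hn : (0 : ℝ) < n := by exact_mod_cast (by omega : 0 < n)
    have hjn : (n : ℝ) ≤ 2 * j := by exact_mod_cast (by omega : n ≤ 2 * j)
    have hjpos : (0 : ℝ) < j := by linarith
    have h1 := succ_mul_risingBinom_succ θ j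
    have h2 := mul_risingBinom_le hθ (show j ≤ n by omega)
    have hpj := risingBinom_pos hθ j
    have hpn := risingBinom_pos hθ n
    have h3 : risingBinom θ j - risingBinom θ (j + 1) =
        -((θ - 1) * (risingBinom θ j / (j + 1))) := by
      field_simp
      linarith
    have h4 : risingBinom θ j / (j + 1) ≤ 4 * (risingBinom θ n / n) := by
      rw [← mul_div_assoc, div_le_div_iff₀ (by positivity) hn]
      have h5 : risingBinom θ j ≤ 2 * risingBinom θ n := by
        by_contra hcon
        push Not at hcon
        nlinarith
      nlinarith
    have h6 : |risingBinom θ j - risingBinom θ (j + 1)| ≤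
        |θ - 1| * (4 * (risingBinom θ n / n)) := by
      rw [h3, abs_neg, abs_mul, abs_of_pos (by positivity : 0 < risingBinom θ j / ((j : ℝ) + 1))]
      gcongr
    calc |risingBinom θ j - risingBinom θ n|
        ≤ |risingBinom θ j - risingBinom θ (j + 1)| + |risingBinom θ (j + 1) - risingBinom θ n| :=
          abs_sub_le _ _ _
      _ ≤ _ := by
          push_cast
          linarith

/-- A telescoping majorant for the tails of `decay (1 + γ)`. -/
theorem gamma_mul_rpow_le_sub {γ x : ℝ} (hγ : 0 < γ) (hx : 0 < x) :
    γ * (x + 1) ^ (-(1 + γ)) ≤ x ^ (-γ) - (x + 1) ^ (-γ) := by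
  have hx1 : 0 < x + 1 := by linarith
  have h1 : 1 + γ * (x + 1)⁻¹ ≤ (x / (x + 1)) ^ (-γ) := by
    rw [Real.rpow_def_of_pos (by positivity)]
    have h2 := Real.log_le_sub_one_of_pos (show 0 < x / (x + 1) by positivity)
    have h3 := Real.add_one_le_exp (Real.log (x / (x + 1)) * -γ)
    have h4 : x / (x + 1) - 1 = -(x + 1)⁻¹ := by
      field_simp
      ring
    rw [h4] at h2
    nlinarith
  rw [Real.div_rpow hx.le hx1.le, le_div_iff₀ (by positivity)] at h1
  have h5 : (x + 1) ^ (-(1 + γ)) = (x + 1)⁻¹ * (x + 1) ^ (-γ) := by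
    rw [neg_add, Real.rpow_add hx1, Real.rpow_neg_one]
  rw [h5]
  linarith

theorem tsum_decay_add_le {γ : ℝ} (hγ : 0 < γ) {m : ℕ} (hm : 1 ≤ m) :
    ∑' i, decay (1 + γ) (i + m) ≤ γ⁻¹ * (m : ℝ) ^ (-γ) := by
  refine Real.tsum_le_of_sum_range_le (fun i => (decay_pos _ _).le) fun N => ?_
  have hm' : (1 : ℝ) ≤ m := by exact_mod_cast hm
  have h1 : ∀ N : ℕ, ∑ i ∈ Finset.range N, decay (1 + γ) (i + m) ≤
      γ⁻¹ * ((m : ℝ) ^ (-γ) - ((m : ℝ) + N) ^ (-γ)) := by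
    intro N
    induction N with
    | zero => simp
    | succ N ih =>
      rw [Finset.sum_range_succ]
      have h2 := gamma_mul_rpow_le_sub hγ (show (0 : ℝ) < m + N by positivity)
      have h3 : decay (1 + γ) (N + m) = ((m : ℝ) + N + 1) ^ (-(1 + γ)) := by
        unfold decay
        push_cast
        congr 1
        ring
      have h4 : decay (1 + γ) (N + m) ≤
          γ⁻¹ * (((m : ℝ) + N) ^ (-γ) - ((m : ℝ) + N + 1) ^ (-γ)) := by
        rw [h3, ← div_eq_inv_mul, le_div_iff₀ hγ]
        linarith
      push_cast
      rw [← add_assoc (m : ℝ)]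
      calc _ ≤ _ := add_le_add ih h4
        _ = _ := by ring
  refine (h1 N).trans ?_
  have : 0 ≤ ((m : ℝ) + N) ^ (-γ) := by positivity
  gcongr
  linarith

/-- The source of the logarithm: each term is at most `n ^ (1 - γ) / (k + 1)`, leaving a harmonic
sum. For `n ≥ 3` one has `log n ≥ 1`, so `1 + log n ≤ 2 log n`. -/
theorem sum_mul_decay_le {γ : ℝ} (hγ1 : γ ≤ 1) {m n : ℕ} (hmn : m ≤ n)
    (hn : 3 ≤ n) :
    ∑ k ∈ Finset.range m, (k : ℝ) * decay (1 + γ) k ≤ (n : ℝ) ^ (1 - γ) * (2 * Real.log n) := by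
  have hlog : 1 ≤ Real.log n := by
    rw [Real.le_log_iff_exp_le (by positivity)]
    have : (3 : ℝ) ≤ n := by exact_mod_cast hn
    linarith [Real.exp_one_lt_d9]
  have h1 : ∀ k ∈ Finset.range m, (k : ℝ) * decay (1 + γ) k ≤
      (n : ℝ) ^ (1 - γ) * ((k : ℝ) + 1)⁻¹ := by
    intro k hk
    have hk' : (k : ℝ) + 1 ≤ n := by
      have := Finset.mem_range.mp hk
      exact_mod_cast (by omega : k + 1 ≤ n)
    have hk0 : (0 : ℝ) < (k : ℝ) + 1 := by positivity
    have h2 : decay (1 + γ) k = ((k : ℝ) + 1) ^ (1 - γ) * ((k : ℝ) + 1)⁻¹ * ((k : ℝ) + 1)⁻¹ := by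
      unfold decay
      rw [← Real.rpow_neg_one, ← Real.rpow_add hk0, ← Real.rpow_add hk0]
      congr 1
      ring
    have h3 : ((k : ℝ) + 1) ^ (1 - γ) ≤ (n : ℝ) ^ (1 - γ) :=
      Real.rpow_le_rpow hk0.le hk' (by linarith)
    calc (k : ℝ) * decay (1 + γ) k ≤ ((k : ℝ) + 1) * decay (1 + γ) k := by
          have := decay_pos (1 + γ) k
          nlinarith
      _ = ((k : ℝ) + 1) ^ (1 - γ) * ((k : ℝ) + 1)⁻¹ := by
          rw [h2]
          field_simp
      _ ≤ _ := by gcongr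
  refine (Finset.sum_le_sum h1).trans ?_
  rw [← Finset.mul_sum]
  gcongr
  have h4 : ∑ k ∈ Finset.range m, ((k : ℝ) + 1)⁻¹ ≤ ∑ k ∈ Finset.range n, ((k : ℝ) + 1)⁻¹ :=
    Finset.sum_le_sum_of_subset_of_nonneg (Finset.range_mono hmn) fun i _ _ => by positivity
  have h5 := harmonic_le_one_add_log n
  rw [harmonic] at h5
  push_cast at h5
  linarith

/-- Convolution of a summable sequence with the coefficients of `(1 - t)^(-θ)`. -/
theorem norm_sum_mul_risingBinom_sub_le {θ γ D : ℝ} (hθ : 0 < θ) (hγ : 0 < γ) (hγ1 : γ ≤ 1)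
    {e : ℕ → ℂ} (he : ∀ n, ‖e n‖ ≤ D * decay (1 + γ) n) {n : ℕ} (hn : 3 ≤ n) :
    ‖∑ k ∈ Finset.range (n + 1), e k * (risingBinom θ (n - k) : ℂ) -
        (∑' k, e k) * (risingBinom θ n : ℂ)‖ ≤
      D * (8 * |θ - 1| + 4 * (θ + 1) / θ + 2 / γ) * risingBinom θ n *
        (Real.log n / (n : ℝ) ^ γ) := by
  have hD : 0 ≤ D := by
    have := (norm_nonneg _).trans (he 0)
    simpa [decay] using this
  have hn0 : (0 : ℝ) < n := by exact_mod_cast (by omega : 0 < n)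
  have hn1 : (1 : ℝ) ≤ n := by exact_mod_cast (by omega : 1 ≤ n)
  have hlog : 1 ≤ Real.log n := by
    rw [Real.le_log_iff_exp_le hn0]
    have : (3 : ℝ) ≤ n := by exact_mod_cast hn
    linarith [Real.exp_one_lt_d9]
  have hpn := risingBinom_pos hθ n
  have hsumm : Summable e :=
    Summable.of_norm_bounded ((summable_decay (by linarith : 1 < 1 + γ)).mul_left D) he
  set p := risingBinom θ with hp
  -- With this cut, `k < m` means `2 * k ≤ n`, while `m ≥ n / 2` as reals.
  obtain ⟨m, hm⟩ : ∃ m, m = n / 2 + 1 := ⟨_, rfl⟩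
  obtain ⟨l, hl⟩ : ∃ l, n + 1 = m + l := ⟨n + 1 - m, by omega⟩
  have hm1 : 1 ≤ m := by omega
  have hnm : (n : ℝ) / 2 ≤ m := by
    have : (n : ℝ) ≤ 2 * m := by exact_mod_cast (by omega : n ≤ 2 * m)
    linarith
  -- Three errors: replacing `p (n - k)` by `p n` for small `k`; the large `k`, where `e` is small
  -- and the `p`'s are bounded by a full partial sum; and the missing tail of `∑ e`.
  have hid : ∑ k ∈ Finset.range (n + 1), e k * (p (n - k) : ℂ) - (∑' k, e k) * (p n : ℂ) =
      ∑ k ∈ Finset.range m, e k * ((p (n - k) - p n : ℝ) : ℂ) +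
        ∑ i ∈ Finset.range l, e (m + i) * (p (n - (m + i)) : ℂ) -
        (∑' i, e (i + m)) * (p n : ℂ) := by
    rw [hl, Finset.sum_range_add, ← hsumm.sum_add_tsum_nat_add m]
    push_cast
    simp_rw [mul_sub, Finset.sum_sub_distrib]
    rw [add_mul, Finset.sum_mul]
    ring
  have hT1 : ‖∑ k ∈ Finset.range m, e k * ((p (n - k) - p n : ℝ) : ℂ)‖ ≤
      D * (4 * |θ - 1|) * (p n / n) * ((n : ℝ) ^ (1 - γ) * (2 * Real.log n)) := by
    refine (norm_sum_le _ _).trans ?_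
    calc _ ≤ ∑ k ∈ Finset.range m,
          D * (4 * |θ - 1|) * (p n / n) * ((k : ℝ) * decay (1 + γ) k) := by
          refine Finset.sum_le_sum fun k hk => ?_
          have hk' := Finset.mem_range.mp hk
          rw [norm_mul, Complex.norm_real, Real.norm_eq_abs]
          calc _ ≤ (D * decay (1 + γ) k) * (4 * |θ - 1| * k * (p n / n)) :=
                mul_le_mul (he k) (abs_risingBinom_sub_le hθ (by omega)) (abs_nonneg _)
                  (mul_nonneg hD (decay_pos _ _).le)
            _ = _ := by ring
      _ ≤ _ := by
          rw [← Finset.mul_sum]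
          exact mul_le_mul_of_nonneg_left (sum_mul_decay_le hγ1 (by omega) hn) (by positivity)
  have hT2 : ‖∑ i ∈ Finset.range l, e (m + i) * (p (n - (m + i)) : ℂ)‖ ≤
      D * (4 * (n : ℝ) ^ (-(1 + γ))) * ((θ + n) / θ * p n) := by
    have hdec : ∀ i, decay (1 + γ) (m + i) ≤ 4 * (n : ℝ) ^ (-(1 + γ)) := by
      intro i
      unfold decay
      calc _ ≤ ((n : ℝ) / 2) ^ (-(1 + γ)) := by
            refine Real.rpow_le_rpow_of_nonpos (by positivity) ?_ (by linarith)
            push_cast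
            have : (0 : ℝ) ≤ i := by positivity
            linarith
        _ = 2 ^ (1 + γ) * (n : ℝ) ^ (-(1 + γ)) := by
            rw [Real.div_rpow hn0.le (by norm_num), Real.rpow_neg (by norm_num : (0:ℝ) ≤ 2),
              div_inv_eq_mul, mul_comm]
        _ ≤ _ := by
            gcongr
            calc (2 : ℝ) ^ (1 + γ) ≤ 2 ^ (2 : ℝ) :=
                  Real.rpow_le_rpow_of_exponent_le (by norm_num) (by linarith)
              _ = 4 := by norm_num
    refine (norm_sum_le _ _).trans ?_
    calc _ ≤ ∑ i ∈ Finset.range l, D * (4 * (n : ℝ) ^ (-(1 + γ))) * p (l - 1 - i) := by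
          refine Finset.sum_le_sum fun i hi => ?_
          have hi' := Finset.mem_range.mp hi
          rw [norm_mul, Complex.norm_real, Real.norm_of_nonneg (risingBinom_pos hθ _).le,
            show n - (m + i) = l - 1 - i by omega]
          refine mul_le_mul_of_nonneg_right ((he _).trans ?_) (risingBinom_pos hθ _).le
          exact mul_le_mul_of_nonneg_left (hdec i) hD
      _ ≤ _ := by
          rw [← Finset.mul_sum, Finset.sum_range_reflect p l]
          refine mul_le_mul_of_nonneg_left ?_ (by positivity)
          rw [div_mul_eq_mul_div, le_div_iff₀ hθ, ← mul_sum_risingBinom, mul_comm]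
          refine mul_le_mul_of_nonneg_left ?_ hθ.le
          exact Finset.sum_le_sum_of_subset_of_nonneg (Finset.range_mono (by omega))
            fun i _ _ => (risingBinom_pos hθ i).le
  have hT3 : ‖(∑' i, e (i + m)) * (p n : ℂ)‖ ≤ D * (γ⁻¹ * (2 * (n : ℝ) ^ (-γ))) * p n := by
    rw [norm_mul, Complex.norm_real, Real.norm_of_nonneg hpn.le]
    refine mul_le_mul_of_nonneg_right ?_ hpn.le
    have hs := (summable_nat_add_iff m).mpr (summable_decay (by linarith : 1 < 1 + γ))
    calc _ ≤ ∑' i, D * decay (1 + γ) (i + m) :=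
          tsum_of_norm_bounded (hs.mul_left D).hasSum fun i => he (i + m)
      _ ≤ D * (γ⁻¹ * (m : ℝ) ^ (-γ)) := by
          rw [tsum_mul_left]
          exact mul_le_mul_of_nonneg_left (tsum_decay_add_le hγ hm1) hD
      _ ≤ _ := by
          gcongr
          calc (m : ℝ) ^ (-γ) ≤ ((n : ℝ) / 2) ^ (-γ) :=
                Real.rpow_le_rpow_of_nonpos (by positivity) hnm (by linarith)
            _ = 2 ^ γ * (n : ℝ) ^ (-γ) := by
                rw [Real.div_rpow hn0.le (by norm_num), Real.rpow_neg (by norm_num : (0:ℝ) ≤ 2),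
                  div_inv_eq_mul, mul_comm]
            _ ≤ _ := by
                gcongr
                calc (2 : ℝ) ^ γ ≤ 2 ^ (1 : ℝ) :=
                      Real.rpow_le_rpow_of_exponent_le (by norm_num) hγ1
                  _ = 2 := by norm_num
  set N := (n : ℝ) ^ (-γ) with hN
  have hNpos : 0 < N := by positivity
  have e1 : (n : ℝ) ^ (1 - γ) = n * N := by
    rw [hN, sub_eq_add_neg, Real.rpow_add hn0, Real.rpow_one]
  have e2 : (n : ℝ) ^ (-(1 + γ)) = (n : ℝ)⁻¹ * N := by
    rw [hN, neg_add, Real.rpow_add hn0, Real.rpow_neg_one]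
  have e3 : Real.log n / (n : ℝ) ^ γ = Real.log n * N := by
    rw [hN, Real.rpow_neg hn0.le, div_eq_mul_inv]
  rw [e1] at hT1
  rw [e2] at hT2
  rw [hid, e3]
  refine ((norm_sub_le _ _).trans (add_le_add_left (norm_add_le _ _) _)).trans ?_
  have b1 : D * (4 * |θ - 1|) * (p n / n) * ((n * N) * (2 * Real.log n)) =
      D * (8 * |θ - 1|) * p n * (Real.log n * N) := by
    field_simp
    ring
  have b2 : D * (4 * ((n : ℝ)⁻¹ * N)) * ((θ + n) / θ * p n) ≤
      D * (4 * (θ + 1) / θ) * p n * (Real.log n * N) := by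
    have h1 : D * (4 * ((n : ℝ)⁻¹ * N)) * ((θ + n) / θ * p n) =
        (4 * D * N * p n / θ) * ((θ + n) / n) := by
      field_simp
    have h2 : D * (4 * (θ + 1) / θ) * p n * (Real.log n * N) =
        (4 * D * N * p n / θ) * ((θ + 1) * Real.log n) := by
      field_simp
    rw [h1, h2]
    refine mul_le_mul_of_nonneg_left ?_ (by positivity)
    rw [div_le_iff₀ hn0]
    have h3 : θ + n ≤ (θ + 1) * n := by nlinarith
    have h4 : (θ + 1) * n ≤ (θ + 1) * Real.log n * n := by
      have : 0 < (θ + 1) * n := by positivity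
      nlinarith
    linarith
  have b3 : D * (γ⁻¹ * (2 * N)) * p n ≤ D * (2 / γ) * p n * (Real.log n * N) := by
    have h1 : D * (γ⁻¹ * (2 * N)) * p n = D * (2 / γ) * p n * N * 1 := by
      field_simp
    have h2 : D * (2 / γ) * p n * (Real.log n * N) = D * (2 / γ) * p n * N * Real.log n := by
      ring
    rw [h1, h2]
    exact mul_le_mul_of_nonneg_left hlog (by positivity)
  calc _ ≤ D * (8 * |θ - 1|) * p n * (Real.log n * N) +
        D * (4 * (θ + 1) / θ) * p n * (Real.log n * N) +
        D * (2 / γ) * p n * (Real.log n * N) := by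
        rw [b1] at hT1
        exact add_le_add (add_le_add hT1 (hT2.trans b2)) (hT3.trans b3)
    _ = _ := by ring

/-! ### The estimate for class `eF` -/

theorem differentiableOn_of_hasSum {f : ℂ → ℂ} {a : ℕ → ℂ} {r : ℝ} (hr : 0 < r)
    (h : ∀ t ∈ Metric.ball (0 : ℂ) r, HasSum (fun n : ℕ => a n * t ^ n) (f t)) :
    DifferentiableOn ℂ f (Metric.ball 0 r) := by
  lift r to NNReal using hr.le
  have h1 : HasFPowerSeriesOnBall f (FormalMultilinearSeries.ofScalars ℂ a) 0 (r : ENNReal) := by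
    refine ⟨ENNReal.le_of_forall_nnreal_lt fun ρ hρ => ?_, by exact_mod_cast hr, fun {y} hy => ?_⟩
    · have hρ' : ((ρ : ℝ) : ℂ) ∈ Metric.ball (0 : ℂ) r := by
        have : ρ < r := by exact_mod_cast hρ
        simpa using this
      refine FormalMultilinearSeries.le_radius_of_tendsto _ (l := 0) ?_
      have h2 := (h _ hρ').summable.tendsto_atTop_zero.norm
      rw [norm_zero] at h2
      refine h2.congr fun n => ?_
      rw [FormalMultilinearSeries.norm_apply_eq_norm_coef,
        FormalMultilinearSeries.coeff_ofScalars, norm_mul, norm_pow, Complex.norm_real,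
        Real.norm_of_nonneg ρ.coe_nonneg]
    · rw [Metric.eball_coe] at hy
      simp only [FormalMultilinearSeries.apply_eq_pow_smul_coeff,
        FormalMultilinearSeries.coeff_ofScalars, smul_eq_mul, zero_add, mul_comm]
      exact h y hy
  have h2 := h1.differentiableOn
  rwa [Metric.eball_coe] at h2

theorem nhdsWithin_ball_neBot {r : ℝ} (hr : 0 < r) :
    (𝓝[Metric.ball (0 : ℂ) r] (r : ℂ)).NeBot := by
  rw [← mem_closure_iff_nhdsWithin_neBot, closure_ball _ hr.ne']
  simp [abs_of_pos hr]

/-- Under `ClassEF`, the decomposition `g = θ log (1 / (1 - t / r)) + g₀` holds in the whole disc. -/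
theorem eq_logSeries_add_taylorSeries {g : PowerSeries ℂ} {r θ : ℝ} (hr : 0 < r) {f g₀ : ℂ → ℂ}
    (hf : ∀ t ∈ Metric.ball (0 : ℂ) r, HasSum (fun n : ℕ => PowerSeries.coeff n g * t ^ n) (f t))
    (hg₀ : AnalyticOnNhd ℂ g₀ (Metric.ball (0 : ℂ) r))
    (hfg : ∀ᶠ t in 𝓝[Metric.ball (0 : ℂ) r] (r : ℂ),
      f t = (θ : ℂ) * Complex.log (1 / (1 - t / (r : ℂ))) + g₀ t) :
    g = logSeries r θ + taylorSeries g₀ := by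
  have hL : DifferentiableOn ℂ (fun t => (θ : ℂ) * Complex.log (1 / (1 - t / (r : ℂ))))
      (Metric.ball 0 r) := fun t ht =>
    ((differentiableAt_log_one_div (one_sub_mem_slitPlane
      (norm_div_lt_one (by simpa using ht)))).const_mul _).differentiableWithinAt
  have hLa := hL.analyticOnNhd Metric.isOpen_ball
  have hfa := (differentiableOn_of_hasSum hr hf).analyticOnNhd Metric.isOpen_ball
  have := nhdsWithin_ball_neBot hr
  -- The decomposition holds near some `z` inside the disc, so the identity theorem propagates it to
  -- the whole disc.
  obtain ⟨z, hz, hzb⟩ :=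
    ((eventually_eventually_nhdsWithin.mpr hfg).and self_mem_nhdsWithin).exists
  rw [Metric.isOpen_ball.nhdsWithin_eq hzb] at hz
  have heq := hfa.eqOn_of_preconnected_of_eventuallyEq (hLa.add hg₀)
    (convex_ball (0 : ℂ) r).isPreconnected hzb hz
  have hball := Metric.ball_mem_nhds (0 : ℂ) hr
  have h0 : (0 : ℂ) ∈ Metric.ball (0 : ℂ) r := Metric.mem_ball_self hr
  have h1 : taylorSeries f = g := taylorSeries_eq_of_hasSum (by
    filter_upwards [hball] with t ht using hf t ht)
  rw [← h1, taylorSeries_congr (g := fun t =>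
    (θ : ℂ) * Complex.log (1 / (1 - t / (r : ℂ))) + g₀ t) (by
      filter_upwards [hball] with t ht using heq ht),
    taylorSeries_add (hLa 0 h0) (hg₀ 0 h0), taylorSeries_log hr]

/-- The shifted profile never vanishes, even at `n = 0`, so an eventual bound becomes one for all
`n`. -/
theorem exists_norm_mul_pow_le_decay {a : ℕ → ℂ} {r γ : ℝ} (hr : 0 < r) (hγ : 0 < γ)
    (ha : a =O[atTop] (fun n : ℕ => (r ^ n)⁻¹ * (n : ℝ) ^ (-1 - γ))) :
    ∃ U : ℝ, ∀ n, ‖(r : ℂ) ^ n * a n‖ ≤ U * decay (1 + γ) n := by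
  have h1 : (fun n : ℕ => (r : ℂ) ^ n * a n) =O[atTop] decay (1 + γ) := by
    obtain ⟨c, hc⟩ := ha.bound
    refine IsBigO.of_bound (c * 2 ^ (1 + γ)) ?_
    filter_upwards [hc, eventually_ge_atTop 1] with n hn hn1
    have hn0 : (1 : ℝ) ≤ n := by exact_mod_cast hn1
    have hrn : 0 < r ^ n := by positivity
    have hx : 0 < (n : ℝ) ^ (-1 - γ) := by positivity
    have hc0 : 0 ≤ c := by
      have := (norm_nonneg _).trans hn
      rw [norm_mul, norm_inv, Real.norm_of_nonneg hrn.le, Real.norm_of_nonneg hx.le] at this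
      exact nonneg_of_mul_nonneg_left this (by positivity)
    have h2 : (n : ℝ) ^ (-1 - γ) ≤ 2 ^ (1 + γ) * decay (1 + γ) n := by
      unfold decay
      calc (n : ℝ) ^ (-1 - γ) ≤ (((n : ℝ) + 1) / 2) ^ (-1 - γ) :=
            Real.rpow_le_rpow_of_nonpos (by positivity) (by linarith) (by linarith)
        _ = _ := by
            rw [show -1 - γ = -(1 + γ) by ring, Real.div_rpow (by positivity) (by norm_num),
              Real.rpow_neg (by norm_num : (0:ℝ) ≤ 2), div_inv_eq_mul, mul_comm]
    rw [norm_mul, norm_inv, Real.norm_of_nonneg hrn.le, Real.norm_of_nonneg hx.le] at hn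
    rw [norm_mul, norm_pow, Complex.norm_real, Real.norm_of_nonneg hr.le,
      Real.norm_of_nonneg (decay_pos _ _).le]
    calc r ^ n * ‖a n‖ ≤ r ^ n * (c * ((r ^ n)⁻¹ * (n : ℝ) ^ (-1 - γ))) := by gcongr
      _ = c * (n : ℝ) ^ (-1 - γ) := by field_simp
      _ ≤ c * (2 ^ (1 + γ) * decay (1 + γ) n) := by gcongr
      _ = _ := by ring
  obtain ⟨C, -, hC⟩ := bound_of_isBigO_nat_atTop h1
  refine ⟨C, fun n => ?_⟩
  have := hC (x := n) (decay_pos _ _).ne'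
  rwa [Real.norm_of_nonneg (decay_pos _ _).le] at this

theorem norm_coeff_cycleSeries_le {θ : ℕ → ℝ} (hθ : ∀ m : ℕ, 1 ≤ m → 0 ≤ θ m) {b m : ℕ}
    (hm : m ∈ Finset.Icc 1 b) (s : ℕ → ℝ) :
    ‖PowerSeries.coeff m (cycleSeries θ b s)‖ ≤ 2 * (θ m / m) := by
  have h1 := hθ m (Finset.mem_Icc.mp hm).1
  have h2 : ‖Complex.exp (Complex.I * (s m : ℂ)) - 1‖ ≤ 2 := by
    refine (norm_sub_le _ _).trans ?_
    rw [mul_comm, Complex.norm_exp_ofReal_mul_I, norm_one]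
    norm_num
  rw [coeff_cycleSeries, if_pos hm, norm_mul, norm_div, Complex.norm_real, Complex.norm_natCast,
    Real.norm_of_nonneg h1, mul_comm]
  gcongr

/-- Any profile works because the support is finite; the point is that `U` does not depend on `s`.
-/
theorem exists_norm_coeff_cycleSeries_le_decay {θ : ℕ → ℝ} (hθ : ∀ m : ℕ, 1 ≤ m → 0 ≤ θ m) (b : ℕ)
    {r : ℝ} (hr : 0 < r) (δ : ℝ) :
    ∃ U : ℝ, ∀ (s : ℕ → ℝ) (n : ℕ),
      ‖(r : ℂ) ^ n * PowerSeries.coeff n (cycleSeries θ b s)‖ ≤ U * decay δ n := by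
  have h0 : ∀ m ∈ Finset.Icc 1 b, 0 ≤ r ^ m * (2 * (θ m / m)) / decay δ m := by
    intro m hm
    have := hθ m (Finset.mem_Icc.mp hm).1
    have := decay_pos δ m
    positivity
  refine ⟨∑ m ∈ Finset.Icc 1 b, r ^ m * (2 * (θ m / m)) / decay δ m, fun s n => ?_⟩
  by_cases hn : n ∈ Finset.Icc 1 b
  · rw [← div_le_iff₀ (decay_pos δ n)]
    refine le_trans ?_ (Finset.single_le_sum h0 hn)
    have := decay_pos δ n
    rw [norm_mul, norm_pow, Complex.norm_real, Real.norm_of_nonneg hr.le]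
    gcongr
    exact norm_coeff_cycleSeries_le hθ hn s
  · rw [coeff_cycleSeries, if_neg hn, mul_zero, norm_zero]
    exact mul_nonneg (Finset.sum_nonneg h0) (decay_pos δ n).le

theorem limitCharFn_eq_exp_tsum (θ : ℕ → ℝ) (r : ℝ) (b : ℕ) (s : ℕ → ℝ) :
    limitCharFn θ r b s =
      Complex.exp (∑' n, (r : ℂ) ^ n * PowerSeries.coeff n (cycleSeries θ b s)) := by
  rw [limitCharFn, tsum_eq_sum (s := Finset.Icc 1 b)]
  · congr 1
    refine Finset.sum_congr rfl fun m hm => ?_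
    rw [coeff_cycleSeries, if_pos hm]
    ring
  · intro n hn
    rw [coeff_cycleSeries, if_neg hn, mul_zero]

-- After `t ↦ r t` the generating function is `(1 - t)^(-θ)` times the exponential of the rescaled
-- regular part, which is a convolution with `risingBinom`.
open PowerSeries in
theorem h_mul_charFn_mul_pow_eq {Θ : ℕ → ℝ} (hΘ : ∀ m : ℕ, 1 ≤ m → 0 ≤ Θ m) (b : ℕ) {r θ : ℝ}
    (hr : 0 < r) {v : PowerSeries ℂ} (hv0 : constantCoeff v = 0)
    (hg : gSeries Θ = logSeries r θ + v) (s : ℕ → ℝ) (n : ℕ) :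
    (h Θ n : ℂ) * charFn Θ n b s * (r : ℂ) ^ n =
      ∑ k ∈ Finset.range (n + 1),
        coeff k (formalExp (rescale (r : ℂ) (v + cycleSeries Θ b s))) *
          (risingBinom θ (n - k) : ℂ) := by
  have h1 := congrArg (coeff n) (mk_h_mul_charFn hΘ b s)
  have hc0 := constantCoeff_cycleSeries Θ b s
  have hvc : constantCoeff (v + cycleSeries Θ b s) = 0 := by simp [hv0, hc0]
  have hr0 : (r : ℂ) ≠ 0 := by exact_mod_cast hr.ne'
  have h2 : formalExp (cycleSeries Θ b s) * GSeries Θ =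
      formalExp (v + cycleSeries Θ b s) *
        PowerSeries.mk fun n => (risingBinom θ n : ℂ) * ((r : ℂ) ^ n)⁻¹ := by
    rw [GSeries, hg, formalExp_add (constantCoeff_logSeries r θ) hv0, formalExp_add hv0 hc0,
      formalExp_logSeries]
    ring
  rw [h2, coeff_mk, coeff_mul, Finset.Nat.sum_antidiagonal_eq_sum_range_succ_mk] at h1
  rw [h1, Finset.sum_mul]
  refine Finset.sum_congr rfl fun k hk => ?_
  have hk' : k ≤ n := by simpa [Nat.lt_succ_iff] using hk
  rw [← rescale_formalExp hvc, coeff_rescale, coeff_mk,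
    show (r : ℂ) ^ n = r ^ k * r ^ (n - k) by rw [← pow_add, Nat.add_sub_cancel' hk']]
  field_simp

open PowerSeries in
theorem charFn_estimate_of_classEF {Θ : ℕ → ℝ} (hΘ : ∀ m : ℕ, 1 ≤ m → 0 ≤ Θ m) (b : ℕ)
    {r θ γ : ℝ} (hθ : 0 < θ) (hcl : ClassEF (gSeries Θ) r θ γ) :
    ∃ A : ℝ, ∀ᶠ n : ℕ in atTop, 0 < h Θ n ∧ ∀ s : ℕ → ℝ,
      ‖charFn Θ n b s - limitCharFn Θ r b s‖ ≤ A * (Real.log (n : ℝ) / (n : ℝ) ^ γ) := by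
  obtain ⟨hr, -, hγ, hγ1, f, g₀, hf, hg₀, hfg, hO⟩ := hcl
  have hδ : 1 < 1 + γ := by linarith
  have hg := eq_logSeries_add_taylorSeries hr hf hg₀ hfg
  have hv0 : constantCoeff (taylorSeries g₀) = 0 := by
    have h1 := congrArg constantCoeff hg
    rw [map_add, constantCoeff_gSeries, constantCoeff_logSeries, zero_add] at h1
    exact h1.symm
  obtain ⟨U₁, hU₁⟩ := exists_norm_mul_pow_le_decay hr hγ hO
  obtain ⟨U₂, hU₂⟩ := exists_norm_coeff_cycleSeries_le_decay hΘ b hr (1 + γ)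
  obtain ⟨Q, hQ0, hQ⟩ := exists_sum_decay_mul_decay_le hδ
  set u : (ℕ → ℝ) → PowerSeries ℂ := fun s =>
    rescale (r : ℂ) (taylorSeries g₀ + cycleSeries Θ b s) with hu
  have hcoeff : ∀ s n, coeff n (u s) = (r : ℂ) ^ n * (iteratedDeriv n g₀ 0 / (n.factorial : ℂ)) +
      (r : ℂ) ^ n * coeff n (cycleSeries Θ b s) := fun s n => by
    rw [hu, coeff_rescale, map_add, coeff_taylorSeries, mul_add]
  have hub : ∀ s n, ‖coeff n (u s)‖ ≤ (U₁ + U₂) * decay (1 + γ) n := fun s n => by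
    rw [hcoeff, add_mul]
    exact (norm_add_le _ _).trans (add_le_add (hU₁ n) (hU₂ s n))
  have hU : 0 ≤ U₁ + U₂ :=
    nonneg_of_mul_nonneg_left ((norm_nonneg _).trans (hub 0 0)) (decay_pos _ 0)
  have hu0 : ∀ s, constantCoeff (u s) = 0 := fun s => by
    rw [← coeff_zero_eq_constantCoeff_apply, hu, coeff_rescale, map_add,
      coeff_zero_eq_constantCoeff_apply, coeff_zero_eq_constantCoeff_apply, hv0,
      constantCoeff_cycleSeries]
    simp
  have hsum₁ : Summable fun n => (r : ℂ) ^ n * (iteratedDeriv n g₀ 0 / (n.factorial : ℂ)) :=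
    Summable.of_norm_bounded ((summable_decay hδ).mul_left U₁) hU₁
  have hsum₂ : ∀ s, Summable fun n => (r : ℂ) ^ n * coeff n (cycleSeries Θ b s) := fun s =>
    Summable.of_norm_bounded ((summable_decay hδ).mul_left U₂) (hU₂ s)
  -- `S` stands for `exp (g₀ r)`: only the Taylor series of `g₀`, not `g₀` itself, is controlled at
  -- the boundary point.
  set S := Complex.exp (∑' n, (r : ℂ) ^ n * (iteratedDeriv n g₀ 0 / (n.factorial : ℂ))) with hS
  have htsum : ∀ s, ∑' n, coeff n (formalExp (u s)) = S * limitCharFn Θ r b s := fun s => by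
    rw [tsum_coeff_formalExp hδ hU (hu0 s) (hub s), limitCharFn_eq_exp_tsum, hS, ← Complex.exp_add,
      ← hsum₁.tsum_add (hsum₂ s)]
    simp_rw [hcoeff]
  have hε : Tendsto (fun n : ℕ => Real.log (n : ℝ) / (n : ℝ) ^ γ) atTop (𝓝 0) :=
    ((isLittleO_log_rpow_atTop hγ).tendsto_div_nhds_zero).comp tendsto_natCast_atTop_atTop
  refine charFn_estimate_of_coeff_estimate hΘ hr b (S := S) (Complex.exp_ne_zero _)
    (p := risingBinom θ) (risingBinom_pos hθ) hε
    (C := Real.exp (Q * (U₁ + U₂)) * (8 * |θ - 1| + 4 * (θ + 1) / θ + 2 / γ)) ?_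
  filter_upwards [eventually_ge_atTop 3] with n hn s
  rw [h_mul_charFn_mul_pow_eq hΘ b hr hv0 hg, ← htsum]
  exact norm_sum_mul_risingBinom_sub_le hθ hγ hγ1
    (norm_coeff_formalExp_le hU hQ hQ0 (hu0 s) (hub s)) hn

/-! ### Coefficient bounds from the size near a boundary singularity -/

/-- The squared norm is `(1 - q)^2 + 2 q (1 - cos x)`, and `1 - cos x ≥ 2 x^2 / π^2 ≥ x^2 / 5`. -/
theorem norm_one_sub_mul_exp_ge {q x : ℝ} (hq : 1 / 2 ≤ q) (hx : |x| ≤ Real.pi) :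
    (1 - q + |x|) / 4 ≤ ‖1 - (q : ℂ) * Complex.exp (x * Complex.I)‖ := by
  refine le_of_sq_le_sq ?_ (norm_nonneg _)
  have h1 : ‖1 - (q : ℂ) * Complex.exp (x * Complex.I)‖ ^ 2 =
      (1 - q) ^ 2 + 2 * q * (1 - Real.cos x) := by
    rw [Complex.sq_norm, Complex.normSq_apply]
    simp only [Complex.sub_re, Complex.one_re, Complex.re_ofReal_mul, Complex.exp_ofReal_mul_I_re,
      Complex.sub_im, Complex.one_im, Complex.im_ofReal_mul, Complex.exp_ofReal_mul_I_im]
    nlinarith [Real.sin_sq_add_cos_sq x]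
  rw [h1]
  have h2 := Real.cos_le_one_sub_mul_cos_sq hx
  have h3 : x ^ 2 / 5 ≤ 2 / Real.pi ^ 2 * x ^ 2 := by
    have h4 : (1 : ℝ) / 5 ≤ 2 / Real.pi ^ 2 := by
      rw [div_le_div_iff₀ (by norm_num) (by positivity)]
      nlinarith [Real.pi_pos, Real.pi_lt_d2]
    nlinarith [sq_nonneg x]
  have h5 : |x| ^ 2 = x ^ 2 := sq_abs x
  have h6 : x ^ 2 / 5 ≤ 2 * q * (1 - Real.cos x) := by
    have : 0 ≤ x ^ 2 := sq_nonneg x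
    nlinarith
  nlinarith [sq_nonneg (1 - q - |x|)]

theorem integral_add_rpow_neg_le {a β : ℝ} (ha : 0 < a) (hβ : 1 < β) :
    ∫ x in (0 : ℝ)..2 * Real.pi, (a + x) ^ (-β) ≤ a ^ (1 - β) / (β - 1) := by
  rw [intervalIntegral.integral_comp_add_left (fun x : ℝ => x ^ (-β)) a, integral_rpow]
  · have h1 : 0 ≤ (a + 2 * Real.pi) ^ (-β + 1) := by
      have := Real.pi_pos
      positivity
    have h2 : ((a + 2 * Real.pi) ^ (-β + 1) - (a + 0) ^ (-β + 1)) / (-β + 1) =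
        (a ^ (1 - β) - (a + 2 * Real.pi) ^ (-β + 1)) / (β - 1) := by
      rw [add_zero, show (1 - β) = -β + 1 by ring, ← neg_div_neg_eq]
      congr 1 <;> ring
    rw [h2]
    have : 0 < β - 1 := by linarith
    gcongr
    linarith
  · right
    refine ⟨by linarith, fun h => ?_⟩
    rw [add_zero, Set.uIcc_of_le (by linarith [Real.pi_pos])] at h
    linarith [h.1]

theorem integral_norm_circleMap_sub_rpow_le {r β : ℝ} (hr : 0 < r) (hβ : 1 < β) (n : ℕ)
    (hn : 1 ≤ n) :
    ∫ x in (0 : ℝ)..2 * Real.pi,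
        ‖circleMap 0 (r * (n / (n + 1))) x - (r : ℂ)‖ ^ (-β) ≤
      (r / 4) ^ (-β) * (2 * (((n : ℝ) + 1) ^ (β - 1) / (β - 1))) := by
  have hn1 : (1 : ℝ) ≤ n := by exact_mod_cast hn
  have hpi := Real.pi_pos
  set a : ℝ := ((n : ℝ) + 1)⁻¹ with ha
  have ha0 : 0 < a := by positivity
  set q : ℝ := n / (n + 1) with hq
  have hqa : 1 - q = a := by
    rw [hq, ha]
    field_simp
    ring
  have hq2 : 1 / 2 ≤ q := by
    rw [hq, div_le_div_iff₀ (by norm_num) (by positivity)]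
    linarith
  have hnorm : ∀ x : ℝ, ‖circleMap 0 (r * q) x - (r : ℂ)‖ =
      r * ‖1 - (q : ℂ) * Complex.exp (x * Complex.I)‖ := by
    intro x
    rw [circleMap_zero, ← norm_neg, ← Real.norm_of_nonneg hr.le, ← Complex.norm_real, ← norm_mul]
    congr 1
    push_cast
    rw [Complex.norm_real, Real.norm_of_nonneg hr.le]
    ring
  -- The angular distance to the positive axis is `x` or `2π - x`; adding both terms avoids
  -- splitting the integral.
  have hlow : ∀ x ∈ Set.Icc 0 (2 * Real.pi),
      ‖circleMap 0 (r * q) x - (r : ℂ)‖ ^ (-β) ≤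
        (r / 4) ^ (-β) * ((a + x) ^ (-β) + (a + (2 * Real.pi - x)) ^ (-β)) := by
    intro x hx
    have key : ∀ y : ℝ, 0 ≤ y → (r / 4) * (a + y) ≤ ‖circleMap 0 (r * q) x - (r : ℂ)‖ →
        ‖circleMap 0 (r * q) x - (r : ℂ)‖ ^ (-β) ≤ (r / 4) ^ (-β) * (a + y) ^ (-β) := by
      intro y hy h
      rw [← Real.mul_rpow (by positivity) (by positivity)]
      exact Real.rpow_le_rpow_of_nonpos (by positivity) h (by linarith)
    have p1 : 0 ≤ (a + x) ^ (-β) := Real.rpow_nonneg (by linarith [hx.1]) _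
    have p2 : 0 ≤ (a + (2 * Real.pi - x)) ^ (-β) := Real.rpow_nonneg (by linarith [hx.2]) _
    have p3 : 0 ≤ (r / 4) ^ (-β) := by positivity
    rw [mul_add]
    rcases le_total x Real.pi with h | h
    · have h1 := norm_one_sub_mul_exp_ge hq2 (show |x| ≤ Real.pi by
        rwa [abs_of_nonneg hx.1])
      rw [abs_of_nonneg hx.1, hqa] at h1
      have h2 := key x hx.1 (by
        rw [hnorm]
        nlinarith)
      nlinarith [mul_nonneg p3 p2]
    · have hy : 0 ≤ 2 * Real.pi - x := by linarith [hx.2]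
      have h1 := norm_one_sub_mul_exp_ge (x := x - 2 * Real.pi) hq2 (by
        rw [abs_of_nonpos (by linarith)]
        linarith)
      rw [abs_of_nonpos (by linarith), hqa, neg_sub] at h1
      have h3 : Complex.exp (((x - 2 * Real.pi : ℝ) : ℂ) * Complex.I) =
          Complex.exp (x * Complex.I) := by
        push_cast
        rw [sub_mul, Complex.exp_sub, Complex.exp_two_pi_mul_I, div_one]
      rw [h3] at h1
      have h2 := key (2 * Real.pi - x) hy (by
        rw [hnorm]
        nlinarith)
      nlinarith [mul_nonneg p3 p1]
  have hpos : ∀ x : ℝ, circleMap 0 (r * q) x - (r : ℂ) ≠ 0 := by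
    intro x h
    have h1 : ‖circleMap 0 (r * q) x‖ = ‖(r : ℂ)‖ := by rw [sub_eq_zero.mp h]
    rw [norm_circleMap_zero, Complex.norm_real, Real.norm_of_nonneg hr.le,
      abs_of_nonneg (by positivity)] at h1
    nlinarith
  have hc1 : IntervalIntegrable (fun x => ‖circleMap 0 (r * q) x - (r : ℂ)‖ ^ (-β))
      MeasureTheory.volume 0 (2 * Real.pi) := by
    refine Continuous.intervalIntegrable ?_ _ _
    refine Continuous.rpow_const (by fun_prop) fun x => Or.inl ?_
    exact norm_ne_zero_iff.mpr (hpos x)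
  have hc2 : IntervalIntegrable (fun x : ℝ => (a + x) ^ (-β))
      MeasureTheory.volume 0 (2 * Real.pi) := by
    refine ContinuousOn.intervalIntegrable fun x hx => ?_
    rw [Set.uIcc_of_le (by linarith)] at hx
    refine (ContinuousAt.rpow_const (by fun_prop) (Or.inl ?_)).continuousWithinAt
    linarith [hx.1]
  have hc3 : IntervalIntegrable (fun x : ℝ => (a + (2 * Real.pi - x)) ^ (-β))
      MeasureTheory.volume 0 (2 * Real.pi) := by
    refine ContinuousOn.intervalIntegrable fun x hx => ?_
    rw [Set.uIcc_of_le (by linarith)] at hx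
    refine (ContinuousAt.rpow_const (by fun_prop) (Or.inl ?_)).continuousWithinAt
    linarith [hx.2]
  refine (intervalIntegral.integral_mono_on (by linarith) hc1
    ((hc2.add hc3).const_mul _) hlow).trans ?_
  rw [intervalIntegral.integral_const_mul, intervalIntegral.integral_add hc2 hc3,
    intervalIntegral.integral_comp_sub_left (fun x : ℝ => (a + x) ^ (-β)) (2 * Real.pi),
    sub_self, sub_zero]
  have h1 := integral_add_rpow_neg_le ha0 hβ
  have h2 : a ^ (1 - β) = ((n : ℝ) + 1) ^ (β - 1) := by
    rw [ha, Real.inv_rpow (by positivity), ← Real.rpow_neg (by positivity), neg_sub]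
  rw [h2] at h1
  refine mul_le_mul_of_nonneg_left ?_ (by positivity)
  linarith

/-- Coefficient bound for a function with an algebraic singularity at `r` of order `β > 1`. -/
theorem exists_norm_coeff_taylorSeries_le_of_norm_le {r β : ℝ} (hr : 0 < r) (hβ : 1 < β) :
    ∃ A : ℝ, 0 ≤ A ∧ ∀ (B : ℝ) (D : ℂ → ℂ), DifferentiableOn ℂ D (Metric.ball 0 r) →
      (∀ t ∈ Metric.ball (0 : ℂ) r, ‖D t‖ ≤ B * ‖t - (r : ℂ)‖ ^ (-β)) →
      ∀ n : ℕ, 1 ≤ n →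
        ‖PowerSeries.coeff n (taylorSeries D)‖ * r ^ n ≤ A * B * (n : ℝ) ^ (β - 1) := by
  have hβ' : 0 < β - 1 := by linarith
  -- The radius is `r n / (n + 1)`. The factor `exp 1` bounds `(1 + 1/n)^n`, and `2 ^ (β - 1)`
  -- passes from `n + 1` to `n`.
  refine ⟨(2 * Real.pi)⁻¹ * ((r / 4) ^ (-β) * (2 / (β - 1))) * 2 ^ (β - 1) * Real.exp 1,
    by have := Real.pi_pos; positivity, fun B D hD hB n hn => ?_⟩
  have hn1 : (1 : ℝ) ≤ n := by exact_mod_cast hn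
  have hpi := Real.pi_pos
  have hB0 : 0 ≤ B := by
    have h1 := (norm_nonneg _).trans (hB 0 (Metric.mem_ball_self hr))
    refine nonneg_of_mul_nonneg_left h1 ?_
    rw [zero_sub, norm_neg, Complex.norm_real, Real.norm_of_nonneg hr.le]
    positivity
  set q : ℝ := n / (n + 1) with hq
  have hq0 : 0 < q := by positivity
  have hq1 : q < 1 := by
    rw [hq, div_lt_one (by positivity)]
    linarith
  have hρ : 0 < r * q := by positivity
  have hρr : r * q < r := by nlinarith
  have h1 := norm_coeff_taylorSeries_le hρ (hD.mono (Metric.closedBall_subset_ball hρr)) n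
  have hmem : ∀ x : ℝ, circleMap 0 (r * q) x ∈ Metric.ball (0 : ℂ) r := fun x => by
    rw [mem_ball_zero_iff, norm_circleMap_zero, abs_of_pos hρ]
    exact hρr
  have h2 : ∫ x in (0 : ℝ)..2 * Real.pi, ‖D (circleMap 0 (r * q) x)‖ ≤
      B * ((r / 4) ^ (-β) * (2 * (((n : ℝ) + 1) ^ (β - 1) / (β - 1)))) := by
    have hpos : ∀ x : ℝ, circleMap 0 (r * q) x - (r : ℂ) ≠ 0 := by
      intro x h
      have := hmem x
      rw [sub_eq_zero.mp h, mem_ball_zero_iff, Complex.norm_real, Real.norm_of_nonneg hr.le] at this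
      exact lt_irrefl _ this
    have hc1 : IntervalIntegrable (fun x => ‖D (circleMap 0 (r * q) x)‖)
        MeasureTheory.volume 0 (2 * Real.pi) := by
      refine Continuous.intervalIntegrable (Continuous.norm ?_) _ _
      exact hD.continuousOn.comp_continuous (continuous_circleMap _ _) hmem
    have hc2 : IntervalIntegrable (fun x => B * ‖circleMap 0 (r * q) x - (r : ℂ)‖ ^ (-β))
        MeasureTheory.volume 0 (2 * Real.pi) := by
      refine Continuous.intervalIntegrable (Continuous.const_mul ?_ _) _ _
      exact Continuous.rpow_const (by fun_prop) fun x => Or.inl (norm_ne_zero_iff.mpr (hpos x))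
    refine (intervalIntegral.integral_mono_on (by linarith) hc1 hc2
      fun x _ => hB _ (hmem x)).trans ?_
    rw [intervalIntegral.integral_const_mul]
    exact mul_le_mul_of_nonneg_left (integral_norm_circleMap_sub_rpow_le hr hβ n hn) hB0
  have h3 : (r * q)⁻¹ ^ n * r ^ n ≤ Real.exp 1 := by
    have h4 : (r * q)⁻¹ ^ n * r ^ n = (1 + (n : ℝ)⁻¹) ^ n := by
      rw [← mul_pow]
      congr 1
      rw [hq]
      field_simp
    rw [h4]
    calc (1 + (n : ℝ)⁻¹) ^ n ≤ (Real.exp ((n : ℝ)⁻¹)) ^ n := by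
          gcongr
          linarith [Real.add_one_le_exp ((n : ℝ)⁻¹)]
      _ = Real.exp 1 := by
          rw [← Real.exp_nat_mul, mul_inv_cancel₀ (by positivity)]
  have h5 : ((n : ℝ) + 1) ^ (β - 1) ≤ 2 ^ (β - 1) * (n : ℝ) ^ (β - 1) := by
    rw [← Real.mul_rpow (by norm_num) (by positivity)]
    exact Real.rpow_le_rpow (by positivity) (by linarith) hβ'.le
  calc ‖PowerSeries.coeff n (taylorSeries D)‖ * r ^ n
      ≤ ((2 * Real.pi)⁻¹ * (B * ((r / 4) ^ (-β) * (2 * (((n : ℝ) + 1) ^ (β - 1) / (β - 1)))))) *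
          (r * q)⁻¹ ^ n * r ^ n := by
        refine mul_le_mul_of_nonneg_right (h1.trans ?_) (by positivity)
        refine mul_le_mul_of_nonneg_right ?_ (by positivity)
        exact mul_le_mul_of_nonneg_left h2 (by positivity)
    _ ≤ ((2 * Real.pi)⁻¹ * (B * ((r / 4) ^ (-β) *
          (2 * ((2 ^ (β - 1) * (n : ℝ) ^ (β - 1)) / (β - 1)))))) * Real.exp 1 := by
        rw [mul_assoc]
        gcongr
    _ = _ := by ring

/-- Coefficient bound for a function of size `‖t - r‖ ^ (1 - θ)` in a neighbourhood of the disc. -/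
theorem exists_norm_coeff_taylorSeries_le_of_norm_le_of_closedBall {r θ c : ℝ} (hr : 0 < r)
    (hθ : 0 < θ) (hc : 0 < c) (hc2 : c ≤ 1 / 2) :
    ∃ A : ℝ, 0 ≤ A ∧ ∀ (M : ℝ) (H : ℂ → ℂ), 0 ≤ M → DifferentiableOn ℂ H (Metric.ball 0 r) →
      (∀ t ∈ Metric.ball (0 : ℂ) r,
        DifferentiableOn ℂ H (Metric.closedBall t (c * ‖t - (r : ℂ)‖))) →
      (∀ t ∈ Metric.ball (0 : ℂ) r, ∀ z ∈ Metric.closedBall t (c * ‖t - (r : ℂ)‖),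
        ‖H z‖ ≤ M * (‖z - (r : ℂ)‖ * ‖z - (r : ℂ)‖ ^ (-θ))) →
      ∀ n : ℕ, 3 ≤ n →
        ‖PowerSeries.coeff n (taylorSeries H)‖ * r ^ n ≤ A * M * (n : ℝ) ^ (θ - 2) := by
  obtain ⟨A, hA0, hA⟩ :=
    exists_norm_coeff_taylorSeries_le_of_norm_le hr (show 1 < 1 + θ by linarith)
  refine ⟨2 * r ^ 2 * A * (2 * (2 * 2 ^ θ) / c ^ 2), by positivity,
    fun M H hM hH hHc hHM n hn => ?_⟩
  -- The order `θ - 1` of `H` itself need not exceed `1`. Two derivatives raise it to `1 + θ > 1`,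
  -- and coefficients of `H` are recovered on dividing by two linear factors in `n`.
  have hD : DifferentiableOn ℂ (deriv (deriv H)) (Metric.ball 0 r) :=
    (hH.deriv Metric.isOpen_ball).deriv Metric.isOpen_ball
  have hDb : ∀ t ∈ Metric.ball (0 : ℂ) r, ‖deriv (deriv H) t‖ ≤
      (2 * (2 * 2 ^ θ) / c ^ 2 * M) * ‖t - (r : ℂ)‖ ^ (-(1 + θ)) := by
    intro t ht
    have hx : 0 < ‖t - (r : ℂ)‖ := by
      rw [norm_pos_iff, sub_ne_zero]
      rintro rfl
      rw [mem_ball_zero_iff, Complex.norm_real, Real.norm_of_nonneg hr.le] at ht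
      exact lt_irrefl _ ht
    set x := ‖t - (r : ℂ)‖ with hxdef
    -- Cauchy's estimate on the circle of radius `c * x`; as `c ≤ 1 / 2`, the distance to `r` on it
    -- lies between `x / 2` and `2 * x`.
    have h1 := Complex.norm_iteratedDeriv_le_of_forall_mem_sphere_norm_le (c := t) (R := c * x)
      (C := M * ((2 * x) * (2 ^ θ * x ^ (-θ)))) (f := H) 2 (by positivity)
      (DifferentiableOn.diffContOnCl ((hHc t ht).mono Metric.closure_ball_subset_closedBall))
      (fun z hz => by
        refine (hHM t ht z (Metric.sphere_subset_closedBall hz)).trans ?_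
        rw [mem_sphere_iff_norm] at hz
        have h2 : ‖z - (r : ℂ)‖ ≤ 2 * x := by
          have := norm_add_le (z - t) (t - (r : ℂ))
          rw [sub_add_sub_cancel, hz] at this
          nlinarith
        have h3 : x / 2 ≤ ‖z - (r : ℂ)‖ := by
          have := norm_sub_le (z - (r : ℂ)) (z - t)
          rw [sub_sub_sub_cancel_left, hz] at this
          nlinarith
        have h4 : ‖z - (r : ℂ)‖ ^ (-θ) ≤ 2 ^ θ * x ^ (-θ) := by
          calc _ ≤ (x / 2) ^ (-θ) :=
                Real.rpow_le_rpow_of_nonpos (by positivity) h3 (by linarith)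
            _ = _ := by
                rw [Real.div_rpow hx.le (by norm_num), Real.rpow_neg (by norm_num : (0:ℝ) ≤ 2),
                  div_inv_eq_mul, mul_comm]
        gcongr)
    rw [iteratedDeriv_succ, iteratedDeriv_one] at h1
    refine h1.trans (le_of_eq ?_)
    rw [neg_add, Real.rpow_add hx, Real.rpow_neg_one]
    simp only [Nat.factorial_two, Nat.cast_ofNat]
    field_simp
  obtain ⟨m, rfl⟩ : ∃ m, n = m + 2 := ⟨n - 2, by omega⟩
  have h1 := hA _ _ hD hDb m (by omega)
  rw [taylorSeries_deriv, taylorSeries_deriv, PowerSeries.coeff_derivative,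
    PowerSeries.coeff_derivative, norm_mul, norm_mul] at h1
  have e1 : ‖((m : ℂ) + 1)‖ = (m : ℝ) + 1 := by
    rw [← Nat.cast_succ, Complex.norm_natCast, Nat.cast_succ]
  have e2 : ‖(((m + 1 : ℕ) : ℂ) + 1)‖ = (m : ℝ) + 2 := by
    rw [← Nat.cast_succ, Complex.norm_natCast]
    push_cast
    ring
  rw [e1, e2, add_sub_cancel_left] at h1
  have hm : (1 : ℝ) ≤ m := by exact_mod_cast (by omega : 1 ≤ m)
  have h2 : (m : ℝ) ^ θ ≤ ((m : ℝ) + 2) ^ θ :=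
    Real.rpow_le_rpow (by positivity) (by linarith) hθ.le
  set a := ‖PowerSeries.coeff (m + 1 + 1) (taylorSeries H)‖ with ha
  set B := 2 * (2 * 2 ^ θ) / c ^ 2 * M with hB
  have hB0 : 0 ≤ B := by positivity
  have h3 : a * r ^ (m + 2) * (((m : ℝ) + 2) ^ 2) ≤ 2 * r ^ 2 * A * B * ((m : ℝ) + 2) ^ θ := by
    have h4 : 0 ≤ a * r ^ m * (m + 2) := by positivity
    calc a * r ^ (m + 2) * (((m : ℝ) + 2) ^ 2)
        = r ^ 2 * ((a * r ^ m * (m + 2)) * (m + 2)) := by ring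
      _ ≤ r ^ 2 * ((a * r ^ m * (m + 2)) * (2 * (m + 1))) := by
          gcongr
          linarith
      _ = 2 * r ^ 2 * (a * ((m : ℝ) + 2) * (m + 1) * r ^ m) := by ring
      _ ≤ 2 * r ^ 2 * (A * B * (m : ℝ) ^ θ) := by gcongr
      _ ≤ 2 * r ^ 2 * (A * B * ((m : ℝ) + 2) ^ θ) := by gcongr
      _ = _ := by ring
  have e3 : (((m + 2 : ℕ) : ℝ)) ^ (θ - 2) = ((m : ℝ) + 2) ^ θ / ((m : ℝ) + 2) ^ 2 := by
    rw [Real.rpow_sub (by positivity)]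
    push_cast
    norm_num
  rw [e3, ← mul_div_assoc, le_div_iff₀ (by positivity)]
  calc _ ≤ _ := h3
    _ = _ := by
      rw [hB]
      ring

/-- Euler's limit for `Γ(θ)` bounds `p_n` below by a multiple of `n ^ (θ - 1)`. -/
theorem exists_rpow_le_mul_risingBinom {θ : ℝ} (hθ : 0 < θ) :
    ∃ c : ℝ, ∀ᶠ n : ℕ in atTop, (n : ℝ) ^ (θ - 2) ≤ c * risingBinom θ n * (1 / n) := by
  have h1 : ∀ n : ℕ, ∏ j ∈ Finset.range n, (θ + j) = n.factorial * risingBinom θ n := by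
    intro n
    rw [risingBinom, Finset.prod_div_distrib, ← Finset.prod_range_add_one_eq_factorial]
    push_cast
    have : ∏ j ∈ Finset.range n, ((j : ℝ) + 1) ≠ 0 :=
      Finset.prod_ne_zero_iff.mpr fun j _ => by positivity
    field_simp
  have h2 := (Real.GammaSeq_tendsto_Gamma θ).eventually_lt_const
    (show Real.Gamma θ < Real.Gamma θ + 1 by linarith)
  have hG := Real.Gamma_pos_of_pos hθ
  refine ⟨(Real.Gamma θ + 1) * (θ + 1), ?_⟩
  filter_upwards [h2, eventually_ge_atTop 1] with n hn hn1
  have hn0 : (1 : ℝ) ≤ n := by exact_mod_cast hn1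
  have hp := risingBinom_pos hθ n
  have hf : (0 : ℝ) < n.factorial := by exact_mod_cast n.factorial_pos
  rw [Real.GammaSeq, Finset.prod_range_succ, h1, div_lt_iff₀ (by positivity)] at hn
  have h3 : (n : ℝ) ^ θ < (Real.Gamma θ + 1) * (risingBinom θ n * (θ + n)) := by
    refine lt_of_mul_lt_mul_right ?_ hf.le
    linarith
  have h4 : (n : ℝ) ^ (θ - 2) = (n : ℝ) ^ θ / (n : ℝ) ^ 2 := by
    rw [Real.rpow_sub (by positivity)]
    norm_num
  rw [h4, div_le_iff₀ (by positivity)]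
  have h5 : (Real.Gamma θ + 1) * (risingBinom θ n * (θ + n)) ≤
      (Real.Gamma θ + 1) * (risingBinom θ n * ((θ + 1) * n)) := by
    gcongr
    nlinarith
  have h6 : (Real.Gamma θ + 1) * (θ + 1) * risingBinom θ n * (1 / n) * (n : ℝ) ^ 2 =
      (Real.Gamma θ + 1) * (risingBinom θ n * ((θ + 1) * n)) := by
    field_simp
  rw [h6]
  linarith

/-! ### The estimate for class `F` -/

/-- The points of the punctured disc of radius `R` around `0` outside the cone with apex `r` in the
positive direction given by `Re (z - r) > κ ‖z - r‖`. -/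
def coneComplement (r R κ : ℝ) : Set ℂ :=
  {z : ℂ | ‖z‖ ≤ R ∧ z ≠ (r : ℂ) ∧ (z - (r : ℂ)).re ≤ κ * ‖z - (r : ℂ)‖}

/-- If `|arg (z - r)| ≤ φ`, then `Re (z - r) ≥ cos φ * ‖z - r‖`, contradicting `κ < cos φ`. The
non-strict conditions make compactness available away from `r`. -/
theorem coneComplement_subset_Delta0 {r R R' φ κ : ℝ} (hR : R' < R)
    (hφ2 : φ < Real.pi / 2) (hκ : κ < Real.cos φ) :
    coneComplement r R' κ ⊆ Delta0 r R φ := by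
  rintro z ⟨hz1, hz2, hz3⟩
  refine ⟨hz1.trans_lt hR, hz2, ?_⟩
  by_contra hcon
  push Not at hcon
  have hx : 0 < ‖z - (r : ℂ)‖ := norm_pos_iff.mpr (sub_ne_zero.mpr hz2)
  have h1 : Real.cos φ ≤ Real.cos (Complex.arg (z - (r : ℂ))) := by
    rw [← Real.cos_abs (Complex.arg _)]
    exact Real.cos_le_cos_of_nonneg_of_le_pi (abs_nonneg _) (by linarith [Real.pi_pos]) hcon
  rw [← Complex.norm_mul_cos_arg] at hz3
  nlinarith

theorem one_sub_div_mem_slitPlane_of_mem_Delta0 {r R φ : ℝ} (hr : 0 < r) (hφ : 0 < φ) {z : ℂ}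
    (hz : z ∈ Delta0 r R φ) : 1 - z / (r : ℂ) ∈ Complex.slitPlane := by
  obtain ⟨-, -, hz3⟩ := hz
  rw [Complex.mem_slitPlane_iff]
  by_contra hcon
  push Not at hcon
  obtain ⟨h1, h2⟩ := hcon
  simp only [Complex.sub_re, Complex.one_re, Complex.div_ofReal_re] at h1
  simp only [Complex.sub_im, Complex.one_im, Complex.div_ofReal_im, zero_sub, neg_eq_zero,
    div_eq_zero_iff, hr.ne', or_false] at h2
  have h3 : z - (r : ℂ) = ((z.re - r : ℝ) : ℂ) := by
    apply Complex.ext <;> simp [h2]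
  have h4 : 0 ≤ z.re - r := by
    have : 1 ≤ z.re / r := by linarith
    rw [le_div_iff₀ hr] at this
    linarith
  rw [h3, Complex.arg_ofReal_of_nonneg h4, abs_zero] at hz3
  linarith

theorem sub_ne_zero_of_mem_ball {r : ℝ} {t : ℂ} (ht : t ∈ Metric.ball (0 : ℂ) r) :
    t ≠ (r : ℂ) := by
  rintro rfl
  rw [mem_ball_zero_iff, Complex.norm_real] at ht
  exact absurd ht (not_lt.mpr (le_abs_self r))

/-- Since `Re (t - r) < 0`, a displacement by `c * ‖t - r‖` gives `Re (z - r) ≤ c * ‖t - r‖`, while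
`‖z - r‖ ≥ ‖t - r‖ / 2`; hence the condition `2 * c ≤ κ`. The condition on `R` uses `‖t - r‖ ≤ 2 *
r`. -/
theorem closedBall_subset_coneComplement {r R κ c : ℝ} (hr : 0 < r) (hc : 0 < c) (hc2 : c ≤ 1 / 2)
    (hcκ : 2 * c ≤ κ) (hcR : r + 2 * c * r ≤ R) {t : ℂ} (ht : t ∈ Metric.ball (0 : ℂ) r) :
    Metric.closedBall t (c * ‖t - (r : ℂ)‖) ⊆ coneComplement r R κ := by
  intro z hz
  rw [mem_closedBall_iff_norm] at hz
  have hne := sub_ne_zero_of_mem_ball ht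
  have hx : 0 < ‖t - (r : ℂ)‖ := norm_pos_iff.mpr (sub_ne_zero.mpr hne)
  rw [mem_ball_zero_iff] at ht
  have hx2 : ‖t - (r : ℂ)‖ ≤ 2 * r := by
    refine (norm_sub_le _ _).trans ?_
    rw [Complex.norm_real, Real.norm_of_nonneg hr.le]
    linarith
  have h1 : ‖t - (r : ℂ)‖ / 2 ≤ ‖z - (r : ℂ)‖ := by
    have := norm_sub_le (z - (r : ℂ)) (z - t)
    rw [sub_sub_sub_cancel_left] at this
    nlinarith
  refine ⟨?_, ?_, ?_⟩
  · have := norm_add_le t (z - t)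
    rw [add_sub_cancel] at this
    nlinarith
  · rintro rfl
    rw [sub_self, norm_zero] at h1
    linarith
  · have h2 : (z - (r : ℂ)).re = (t.re - r) + (z - t).re := by simp
    have h3 : t.re < r := (Complex.re_le_norm t).trans_lt ht
    have h4 := Complex.re_le_norm (z - t)
    rw [h2]
    nlinarith

/-- Near `r` this is the `O` hypothesis; at distance at least `δ` from `r`, `g` is bounded by
compactness. -/
theorem exists_norm_sub_le_of_isBigO {r R R' φ κ : ℝ} (hR : R' < R) (hφ2 : φ < Real.pi / 2)
    (hκ : κ < Real.cos φ) {g : ℂ → ℂ} {K : ℂ} (hg : ContinuousOn g (Delta0 r R φ))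
    (hO : (fun t : ℂ => g t - K) =O[𝓝[Delta0 r R φ] (r : ℂ)] (fun t : ℂ => t - (r : ℂ))) :
    ∃ B : ℝ, 0 ≤ B ∧ ∀ z ∈ coneComplement r R' κ, ‖g z - K‖ ≤ B * ‖z - (r : ℂ)‖ := by
  have hsub := coneComplement_subset_Delta0 (r := r) hR hφ2 hκ
  obtain ⟨B₁, hB₁0, hB₁⟩ := hO.exists_nonneg
  obtain ⟨δ, hδ, hball⟩ := Metric.mem_nhdsWithin_iff.mp hB₁.bound
  set T : Set ℂ := {z : ℂ | ‖z‖ ≤ R' ∧ δ ≤ ‖z - (r : ℂ)‖ ∧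
    (z - (r : ℂ)).re ≤ κ * ‖z - (r : ℂ)‖} with hT
  have hTsub : T ⊆ coneComplement r R' κ := by
    rintro z ⟨h1, h2, h3⟩
    refine ⟨h1, ?_, h3⟩
    rintro rfl
    rw [sub_self, norm_zero] at h2
    linarith
  have hTc : IsCompact T := by
    refine (isCompact_closedBall (0 : ℂ) R').of_isClosed_subset ?_ fun z hz => ?_
    · have h1 : IsClosed {z : ℂ | ‖z‖ ≤ R'} := isClosed_le continuous_norm continuous_const
      have h2 : IsClosed {z : ℂ | δ ≤ ‖z - (r : ℂ)‖} := isClosed_le (by fun_prop) (by fun_prop)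
      have h3 : IsClosed {z : ℂ | (z - (r : ℂ)).re ≤ κ * ‖z - (r : ℂ)‖} :=
        isClosed_le (Complex.continuous_re.comp (by fun_prop)) (by fun_prop)
      exact h1.inter (h2.inter h3)
    · simpa using hz.1
  obtain ⟨M, hM⟩ := hTc.exists_bound_of_continuousOn (f := fun z => g z - K)
    ((hg.mono (hTsub.trans hsub)).sub continuousOn_const)
  refine ⟨max B₁ (|M| / δ), le_max_of_le_left hB₁0, fun z hz => ?_⟩
  by_cases h : ‖z - (r : ℂ)‖ < δ
  · have h1 := hball ⟨by rwa [mem_ball_iff_norm], hsub hz⟩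
    simp only [Set.mem_ofPred_eq] at h1
    exact h1.trans (by gcongr; exact le_max_left _ _)
  · push Not at h
    have h1 := hM z ⟨hz.1, h, hz.2.2⟩
    calc _ ≤ |M| := h1.trans (le_abs_self M)
      _ ≤ |M| / δ * ‖z - (r : ℂ)‖ := by
        rw [div_mul_eq_mul_div, le_div_iff₀ hδ]
        gcongr
      _ ≤ _ := by gcongr; exact le_max_right _ _

/-- The polynomial `∑_{m=1}^b (θ_m / m) (e^{i s_m} - 1) t^m`, as a function. -/
def cyclePoly (θ : ℕ → ℝ) (b : ℕ) (s : ℕ → ℝ) (t : ℂ) : ℂ :=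
  ∑ m ∈ Finset.Icc 1 b, PowerSeries.coeff m (cycleSeries θ b s) * t ^ m

theorem differentiable_cyclePoly (θ : ℕ → ℝ) (b : ℕ) (s : ℕ → ℝ) :
    Differentiable ℂ (cyclePoly θ b s) := by
  unfold cyclePoly
  fun_prop

theorem cyclePoly_zero (θ : ℕ → ℝ) (b : ℕ) (s : ℕ → ℝ) : cyclePoly θ b s 0 = 0 := by
  refine Finset.sum_eq_zero fun m hm => ?_
  have : m ≠ 0 := by
    have := (Finset.mem_Icc.mp hm).1
    omega
  simp [this]

theorem taylorSeries_cyclePoly (θ : ℕ → ℝ) (b : ℕ) (s : ℕ → ℝ) :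
    taylorSeries (cyclePoly θ b s) = cycleSeries θ b s := by
  refine taylorSeries_eq_of_hasSum (Eventually.of_forall fun t => ?_)
  refine hasSum_sum_of_ne_finset_zero fun m hm => ?_
  rw [coeff_cycleSeries, if_neg hm, zero_mul]

theorem exp_cyclePoly_eq_limitCharFn (θ : ℕ → ℝ) (r : ℝ) (b : ℕ) (s : ℕ → ℝ) :
    Complex.exp (cyclePoly θ b s r) = limitCharFn θ r b s := by
  rw [limitCharFn, cyclePoly]
  congr 1
  refine Finset.sum_congr rfl fun m hm => ?_
  rw [coeff_cycleSeries, if_pos hm]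

theorem exists_norm_pow_sub_pow_le (R : ℝ) (m : ℕ) :
    ∃ L : ℝ, 0 ≤ L ∧ ∀ z w : ℂ, ‖z‖ ≤ R → ‖w‖ ≤ R → ‖z ^ m - w ^ m‖ ≤ L * ‖z - w‖ := by
  induction m with
  | zero => exact ⟨0, le_rfl, by simp⟩
  | succ m ih =>
    obtain ⟨L, hL, ih⟩ := ih
    refine ⟨|R| * L + |R| ^ m, by positivity, fun z w hz hw => ?_⟩
    have h1 : z ^ (m + 1) - w ^ (m + 1) = z * (z ^ m - w ^ m) + w ^ m * (z - w) := by ring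
    rw [h1, add_mul]
    refine (norm_add_le _ _).trans (add_le_add ?_ ?_)
    · rw [norm_mul, mul_assoc]
      exact mul_le_mul (hz.trans (le_abs_self R)) (ih z w hz hw) (norm_nonneg _) (abs_nonneg _)
    · rw [norm_mul, norm_pow]
      gcongr
      exact hw.trans (le_abs_self R)

theorem exists_norm_cyclePoly_sub_le {θ : ℕ → ℝ} (hθ : ∀ m : ℕ, 1 ≤ m → 0 ≤ θ m) (b : ℕ) (R : ℝ) :
    ∃ L : ℝ, 0 ≤ L ∧ ∀ (s : ℕ → ℝ) (z w : ℂ), ‖z‖ ≤ R → ‖w‖ ≤ R →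
      ‖cyclePoly θ b s z - cyclePoly θ b s w‖ ≤ L * ‖z - w‖ := by
  choose L hL0 hL using exists_norm_pow_sub_pow_le R
  have h0 : ∀ m ∈ Finset.Icc 1 b, 0 ≤ 2 * (θ m / m) := fun m hm => by
    have := hθ m (Finset.mem_Icc.mp hm).1
    positivity
  refine ⟨∑ m ∈ Finset.Icc 1 b, 2 * (θ m / m) * L m,
    Finset.sum_nonneg fun m hm => mul_nonneg (h0 m hm) (hL0 m), fun s z w hz hw => ?_⟩
  rw [cyclePoly, cyclePoly, ← Finset.sum_sub_distrib, Finset.sum_mul]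
  refine (norm_sum_le _ _).trans (Finset.sum_le_sum fun m hm => ?_)
  rw [← mul_sub, norm_mul, mul_assoc]
  exact mul_le_mul (norm_coeff_cycleSeries_le hθ hm s) (hL m z w hz hw) (norm_nonneg _) (h0 m hm)

theorem norm_exp_sub_exp_le (x y : ℂ) :
    ‖Complex.exp x - Complex.exp y‖ ≤ ‖x - y‖ * Real.exp ‖x - y‖ * ‖Complex.exp y‖ := by
  have h1 : Complex.exp x - Complex.exp y = (Complex.exp (x - y) - 1) * Complex.exp y := by
    rw [sub_mul, one_mul, ← Complex.exp_add, sub_add_cancel]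
  have h2 := Complex.norm_exp_sub_sum_le_norm_mul_exp (x - y) 1
  simp only [Finset.sum_range_one, pow_zero, Nat.factorial_zero, Nat.cast_one, div_one,
    pow_one] at h2
  rw [h1, norm_mul]
  gcongr

/-- For real `θ` only the real part of the logarithm matters, so no branch condition is needed. -/
theorem norm_exp_mul_log_one_div {r : ℝ} (hr : 0 < r) (θ : ℝ) {z : ℂ} (hz : z ≠ (r : ℂ)) :
    ‖Complex.exp ((θ : ℂ) * Complex.log (1 / (1 - z / (r : ℂ))))‖ =
      r ^ θ * ‖z - (r : ℂ)‖ ^ (-θ) := by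
  have hx : 0 < ‖z - (r : ℂ)‖ := norm_pos_iff.mpr (sub_ne_zero.mpr hz)
  have hr0 : (r : ℂ) ≠ 0 := by exact_mod_cast hr.ne'
  have h1 : 1 / (1 - z / (r : ℂ)) = -((r : ℂ) / (z - (r : ℂ))) := by
    have h2 : z - (r : ℂ) ≠ 0 := sub_ne_zero.mpr hz
    have h3 : (r : ℂ) - z ≠ 0 := sub_ne_zero.mpr hz.symm
    have h4 : 1 - z / (r : ℂ) ≠ 0 := by
      rw [one_sub_div hr0]
      exact div_ne_zero h3 hr0
    rw [one_sub_div hr0, one_div_div, ← div_neg, neg_sub]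
  have h2 : ‖1 / (1 - z / (r : ℂ))‖ = r / ‖z - (r : ℂ)‖ := by
    rw [h1, norm_neg, norm_div, Complex.norm_real, Real.norm_of_nonneg hr.le]
  rw [Complex.norm_exp, Complex.re_ofReal_mul, Complex.log_re, h2, mul_comm,
    ← Real.rpow_def_of_pos (by positivity), Real.div_rpow hr.le hx.le, Real.rpow_neg hx.le,
    div_eq_mul_inv]

theorem charFn_estimate_of_classF {Θ : ℕ → ℝ} (hΘ : ∀ m : ℕ, 1 ≤ m → 0 ≤ Θ m) (b : ℕ)
    {r θ : ℝ} (hθ : 0 < θ) (hcl : ClassF (gSeries Θ) r θ) :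
    ∃ A : ℝ, ∀ᶠ n : ℕ in atTop, 0 < h Θ n ∧ ∀ s : ℕ → ℝ,
      ‖charFn Θ n b s - limitCharFn Θ r b s‖ ≤ A * (1 / (n : ℝ)) := by
  obtain ⟨hr, -, R, φ, hR, hφ, hφ2, f, hf, hfsum, K, hO⟩ := hcl
  have hcos : 0 < Real.cos φ := Real.cos_pos_of_mem_Ioo ⟨by linarith [Real.pi_pos], hφ2⟩
  have hr0 : (r : ℂ) ≠ 0 := by exact_mod_cast hr.ne'
  obtain ⟨κ, hκ0, hκ⟩ : ∃ κ, 0 < κ ∧ κ < Real.cos φ := exists_between hcos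
  obtain ⟨R', hrR', hR'⟩ : ∃ R', r < R' ∧ R' < R := exists_between hR
  obtain ⟨c, hc, hc2, hcκ, hcR⟩ : ∃ c, 0 < c ∧ c ≤ 1 / 2 ∧ 2 * c ≤ κ ∧ r + 2 * c * r ≤ R' := by
    refine ⟨min (1 / 2) (min (κ / 2) ((R' - r) / (2 * r))), ?_, min_le_left _ _, ?_, ?_⟩
    · have : 0 < R' - r := by linarith
      positivity
    · have := (min_le_right (1 / 2) (min (κ / 2) ((R' - r) / (2 * r)))).trans (min_le_left _ _)
      linarith
    · have := (min_le_right (1 / 2) (min (κ / 2) ((R' - r) / (2 * r)))).trans (min_le_right _ _)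
      rw [le_div_iff₀ (by positivity)] at this
      linarith
  have hsub := coneComplement_subset_Delta0 (r := r) hR' hφ2 hκ
  have hcb : ∀ t ∈ Metric.ball (0 : ℂ) r,
      Metric.closedBall t (c * ‖t - (r : ℂ)‖) ⊆ coneComplement r R' κ := fun t ht =>
    closedBall_subset_coneComplement hr hc hc2 hcκ hcR ht
  have hballsub : Metric.ball (0 : ℂ) r ⊆ Delta0 r R φ := fun t ht =>
    hsub (hcb t ht (Metric.mem_closedBall_self (by positivity)))
  set L : ℂ → ℂ := fun t => (θ : ℂ) * Complex.log (1 / (1 - t / (r : ℂ))) with hL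
  have hLd : DifferentiableOn ℂ L (Delta0 r R φ) := fun t ht =>
    ((differentiableAt_log_one_div
      (one_sub_div_mem_slitPlane_of_mem_Delta0 hr hφ ht)).const_mul _).differentiableWithinAt
  obtain ⟨B₁, hB₁0, hB₁⟩ := exists_norm_sub_le_of_isBigO hR' hφ2 hκ (g := fun t => f t - L t)
    (K := K) (hf.sub hLd).continuousOn (by simpa only [hL, sub_sub] using hO)
  obtain ⟨B₂, hB₂0, hB₂⟩ := exists_norm_cyclePoly_sub_le hΘ b R'
  obtain ⟨A, hA0, hA⟩ := exists_norm_coeff_taylorSeries_le_of_norm_le_of_closedBall hr hθ hc hc2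
  set P : (ℕ → ℝ) → ℂ → ℂ := cyclePoly Θ b with hP
  -- The generating function minus its singular model; its coefficients are exactly the errors to be
  -- bounded.
  set H : (ℕ → ℝ) → ℂ → ℂ := fun s t =>
    Complex.exp (f t + P s t) + -(Complex.exp K * limitCharFn Θ r b s) * Complex.exp (L t) with hH
  have hHd : ∀ s, DifferentiableOn ℂ (H s) (Delta0 r R φ) := fun s =>
    ((hf.add (differentiable_cyclePoly Θ b s).differentiableOn).cexp).add
      (hLd.cexp.const_mul _)
  set E := Real.exp ((B₁ + B₂) * (R' + r)) with hE
  have hHb : ∀ s, ∀ z ∈ coneComplement r R' κ, ‖H s z‖ ≤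
      (r ^ θ * ((B₁ + B₂) * E * ‖Complex.exp K‖)) *
        (‖z - (r : ℂ)‖ * ‖z - (r : ℂ)‖ ^ (-θ)) := by
    intro s z hz
    -- With the singular factor taken out, the difference of exponentials is `O(‖z - r‖)` uniformly
    -- in `s`: `f - L` tends to `K` linearly and `P s` is Lipschitz with a constant free of `s`.
    have hid : H s z = Complex.exp (L z) *
        (Complex.exp ((f z - L z) + P s z) - Complex.exp (K + P s r)) := by
      rw [hH, mul_sub, ← Complex.exp_add, Complex.exp_add K, hP, exp_cyclePoly_eq_limitCharFn]
      ring_nf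
    have hrR : ‖(r : ℂ)‖ ≤ R' := by
      rw [Complex.norm_real, Real.norm_of_nonneg hr.le]
      exact hrR'.le
    have h1 : ‖((f z - L z) + P s z) - (K + P s r)‖ ≤ (B₁ + B₂) * ‖z - (r : ℂ)‖ := by
      rw [add_sub_add_comm, add_mul]
      exact (norm_add_le _ _).trans (add_le_add (hB₁ z hz) (hB₂ s z r hz.1 hrR))
    have h2 : ‖z - (r : ℂ)‖ ≤ R' + r := by
      refine (norm_sub_le _ _).trans (add_le_add hz.1 ?_)
      rw [Complex.norm_real, Real.norm_of_nonneg hr.le]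
    have h3 : ‖Complex.exp (K + P s r)‖ ≤ ‖Complex.exp K‖ := by
      rw [Complex.exp_add, norm_mul, hP, exp_cyclePoly_eq_limitCharFn]
      exact mul_le_of_le_one_right (norm_nonneg _) (norm_limitCharFn_le_one hΘ hr.le b s)
    rw [hid, norm_mul, norm_exp_mul_log_one_div hr θ hz.2.1]
    calc _ ≤ (r ^ θ * ‖z - (r : ℂ)‖ ^ (-θ)) *
          (((B₁ + B₂) * ‖z - (r : ℂ)‖) * E * ‖Complex.exp K‖) := by
          refine mul_le_mul_of_nonneg_left ((norm_exp_sub_exp_le _ _).trans ?_) (by positivity)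
          have h4 : Real.exp ‖((f z - L z) + P s z) - (K + P s r)‖ ≤ E :=
            Real.exp_le_exp.mpr (h1.trans (by gcongr))
          gcongr
      _ = _ := by ring
  have h0ball : (0 : ℂ) ∈ Metric.ball (0 : ℂ) r := Metric.mem_ball_self hr
  have han : ∀ {g : ℂ → ℂ}, DifferentiableOn ℂ g (Delta0 r R φ) → AnalyticAt ℂ g 0 := fun hg =>
    (hg.mono hballsub).analyticOnNhd Metric.isOpen_ball 0 h0ball
  have hft : taylorSeries f = gSeries Θ := taylorSeries_eq_of_hasSum hfsum
  have hf0 : f 0 = 0 := by rw [← constantCoeff_taylorSeries f, hft, constantCoeff_gSeries]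
  have hL0 : L 0 = 0 := by simp [hL]
  have hcoeff : ∀ s n, (h Θ n : ℂ) * charFn Θ n b s * (r : ℂ) ^ n -
      Complex.exp K * limitCharFn Θ r b s * (risingBinom θ n : ℂ) =
        PowerSeries.coeff n (taylorSeries (H s)) * (r : ℂ) ^ n := by
    intro s n
    have hPa : AnalyticAt ℂ (P s) 0 := (differentiable_cyclePoly Θ b s).analyticAt 0
    have hP0 : P s 0 = 0 := cyclePoly_zero Θ b s
    have hfP : AnalyticAt ℂ (fun t => f t + P s t) 0 := (han hf).add hPa
    have he : AnalyticAt ℂ (fun t => Complex.exp (f t + P s t)) 0 := hfP.cexp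
    have heL : AnalyticAt ℂ (fun t => Complex.exp (L t)) 0 := (han hLd).cexp
    have h1 : taylorSeries (H s) = formalExp (cycleSeries Θ b s) * GSeries Θ +
        PowerSeries.C (-(Complex.exp K * limitCharFn Θ r b s)) * formalExp (logSeries r θ) := by
      rw [hH, taylorSeries_add he (analyticAt_const.fun_mul heL),
        taylorSeries_mul analyticAt_const heL, taylorSeries_const,
        taylorSeries_exp (han hLd) hL0, hL, taylorSeries_log hr,
        taylorSeries_exp hfP (by rw [hf0, hP0, add_zero]),
        taylorSeries_add (han hf) hPa, hft, hP, taylorSeries_cyclePoly,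
        formalExp_add (constantCoeff_gSeries Θ) (constantCoeff_cycleSeries Θ b s), GSeries,
        mul_comm (formalExp (gSeries Θ))]
    have hrn : (r : ℂ) ^ n ≠ 0 := pow_ne_zero _ hr0
    rw [h1, ← mk_h_mul_charFn hΘ, formalExp_logSeries, map_add, PowerSeries.coeff_C_mul,
      PowerSeries.coeff_mk, PowerSeries.coeff_mk]
    field_simp
    ring
  obtain ⟨c', hc'⟩ := exists_rpow_le_mul_risingBinom hθ
  set M := r ^ θ * ((B₁ + B₂) * E * ‖Complex.exp K‖) with hM
  have hM0 : 0 ≤ M := by positivity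
  refine charFn_estimate_of_coeff_estimate hΘ hr b (S := Complex.exp K) (Complex.exp_ne_zero _)
    (p := risingBinom θ) (risingBinom_pos hθ) tendsto_one_div_atTop_nhds_zero_nat
    (C := A * M * c') ?_
  filter_upwards [hc', eventually_ge_atTop 3] with n hn hn3 s
  rw [hcoeff, norm_mul, norm_pow, Complex.norm_real, Real.norm_of_nonneg hr.le]
  refine (hA M (H s) hM0 ((hHd s).mono hballsub)
    (fun t ht => (hHd s).mono ((hcb t ht).trans hsub))
    (fun t ht z hz => hHb s z (hcb t ht hz)) n hn3).trans ?_
  calc A * M * (n : ℝ) ^ (θ - 2) ≤ A * M * (c' * risingBinom θ n * (1 / n)) := by gcongr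
    _ = _ := by ring

end WeightedPerm

end

theorem mainTheorem1 (Θ : ℕ → ℝ) (hΘ : ∀ m : ℕ, 1 ≤ m → 0 ≤ Θ m) (b : ℕ) :
    (∀ s : ℕ → ℝ,
      PowerSeries.mk (fun n : ℕ =>
          (WeightedPerm.h Θ n : ℂ) * WeightedPerm.charFn Θ n b s) =
        WeightedPerm.formalExp (WeightedPerm.cycleSeries Θ b s) * WeightedPerm.GSeries Θ) ∧
    (∀ r θ : ℝ, 0 < θ → WeightedPerm.ClassF (WeightedPerm.gSeries Θ) r θ →
      ∃ A : ℝ, ∀ᶠ n : ℕ in Filter.atTop, 0 < WeightedPerm.h Θ n ∧ ∀ s : ℕ → ℝ,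
        ‖WeightedPerm.charFn Θ n b s - WeightedPerm.limitCharFn Θ r b s‖ ≤ A * (1 / (n : ℝ))) ∧
    (∀ r θ γ : ℝ, 0 < θ → WeightedPerm.ClassEF (WeightedPerm.gSeries Θ) r θ γ →
      ∃ A : ℝ, ∀ᶠ n : ℕ in Filter.atTop, 0 < WeightedPerm.h Θ n ∧ ∀ s : ℕ → ℝ,
        ‖WeightedPerm.charFn Θ n b s - WeightedPerm.limitCharFn Θ r b s‖ ≤
          A * (Real.log (n : ℝ) / (n : ℝ) ^ γ)) :=
  ⟨fun s => WeightedPerm.mk_h_mul_charFn hΘ b s,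
    fun _ _ hθ hcl => WeightedPerm.charFn_estimate_of_classF hΘ b hθ hcl,
    fun _ _ _ hθ hcl => WeightedPerm.charFn_estimate_of_classEF hΘ b hθ hcl⟩
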